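/- **Definitions.** Relation names, variables and constants (data values) are taken from countably infinite sets. A *database* $\mathbf{DB}$ over a finite schema of relation names with arities consists of a finite set of ground atoms (facts) $r(a_1,\dots,a_m)$ that respect the schema, and of a finite universe $U$ that contains all data values occurring in the facts. A *conjunctive query* is a rule $$Q:\quad ans(\mathbf u)\leftarrow r_1(\mathbf u_1)\wedge\dots\wedge r_n(\mathbf u_n),\qquad n\ge 0,$$ where $\mathbf u,\mathbf u_1,\dots,\mathbf u_n$ are finite lists of variables and constants and the lengths of the $\mathbf u_i$ agree with the arities; $Q$ need not be Boolean, that is, $\mathbf u$ may contain variables. $atoms(Q)$ is the set of body atoms, $var(A)$ the set of variables of an atom $A$, $var(R)=\bigcup_{A\in R}var(A)$ for a set $R$ of atoms, and $var(Q)$ the set of variables occurring in $Q$. The *answer* of $Q$ on $\mathbf{DB}$ is the finite relation of all tuples $\mathbf u\theta$ with $\theta:var(Q)\to U$ such that $r_i(\mathbf u_i)\theta\in\mathbf{DB}$ for all $i$. A *hypertree decomposition* of $Q$ is a finite rooted tree $T$ whose vertices $p$ are labelled by sets $\chi(p)\subseteq var(Q)$ and $\lambda(p)\subseteq atoms(Q)$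 such that: 1. for each $A\in atoms(Q)$ there is a vertex $p$ with $var(A)\subseteq\chi(p)$; 2. for each $Y\in var(Q)$, the set of vertices $p$ with $Y\in\chi(p)$ induces a (possibly empty) connected subtree of $T$; 3. $\chi(p)\subseteq var(\lambda(p))$ for each vertex $p$; 4. $var(\lambda(p))\cap\bigcup_{q\in T_p}\chi(q)\subseteq\chi(p)$ for each vertex $p$, where $T_p$ is the subtree rooted at $p$. Its *width* is $\max_p|\lambda(p)|$. The *size* of an instance or a relation is the length of its standard encoding as a word over a fixed finite alphabet (numbers in binary; finite sets written as lists; trees as lists of vertices, parents first, with parent pointers and labels). **Theorem.** Let $k>0$ be a fixed integer. There are a deterministic multi-stack Turing machine $M$ and a polynomial $p$ (both depending only on $k$) such that, for every database $\mathbf{DB}$, every (not necessarily Boolean) conjunctive query $Q$, and every hypertree decomposition $H\!D$ of $Q$ of width at most $k$, the machine $M$, on input $\langle \mathbf{DB},Q,H\!D\rangle$, outputs a list, without repetitions, of exactly the tuples of the answer of $Q$ on $\mathbf{DB}$, and halts within $p(N+S)$ steps, where $N$ is the size of the input $\langle\mathbf{DB},Q,H\!D\rangle$ and $S$ is the size of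 the answer relation. -/

import Mathlib

namespace ConjQuery

/-! ### Databases and conjunctive queries

Relation names, variables and data values (constants) are drawn from countably infinite sets,
each of which is identified with `ℕ`. Finite sets that are part of an input instance are presented
by lists; their meaning depends on membership only, never on order or repetition. -/

/-- A database schema: finitely many relation names, each with its arity. -/
structure Schema where
  names : Finset ℕ
  arity : ℕ → ℕ

/-- A ground atom `r(a₁, …, aₘ)`, i.e. a tuple `⟨a₁, …, aₘ⟩` of the relation `r`. -/
structure Fact where
  rel : ℕ
  args : List ℕ
deriving DecidableEq

/-- A database instance, identified with its set of ground facts, together with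
its finite universe `dom`. -/
structure Database where
  facts : List Fact
  dom : List ℕ

/-- `DB` is a database instance over the schema `S`: every fact belongs to a relation of `S` and
has the right arity, and every data value that occurs in a fact is in the universe. -/
def Database.IsOver (DB : Database) (S : Schema) : Prop :=
  ∀ f ∈ DB.facts, f.rel ∈ S.names ∧ f.args.length = S.arity f.rel ∧
    ∀ a ∈ f.args, a ∈ DB.dom

/-- A term is a variable or a constant. -/
inductive Term where
  | var (x : ℕ)
  | const (c : ℕ)
deriving DecidableEq

/-- The variables occurring in a list of terms. -/
def varsOf (ts : List Term) : Set ℕ := {x | Term.var x ∈ ts}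

/-- The value of a term under a substitution. -/
def Term.subst (θ : ℕ → ℕ) : Term → ℕ
  | .var x => θ x
  | .const c => c

/-- A body atom `r(u)`. -/
structure Atom where
  rel : ℕ
  args : List Term
deriving DecidableEq

/-- `var(A)`. -/
def Atom.vars (A : Atom) : Set ℕ := varsOf A.args

/-- The ground atom `Aθ`. -/
def Atom.subst (θ : ℕ → ℕ) (A : Atom) : Fact := ⟨A.rel, A.args.map (Term.subst θ)⟩

/-- A conjunctive query `ans(u) ← r₁(u₁) ∧ ⋯ ∧ rₙ(uₙ)`: `head` is the list of terms `u`,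
`body` is the list of the atoms `rᵢ(uᵢ)`. -/
structure Query where
  head : List Term
  body : List Atom

/-- `Q` is a query on the schema `S`. -/
def Query.IsOver (Q : Query) (S : Schema) : Prop :=
  ∀ A ∈ Q.body, A.rel ∈ S.names ∧ A.args.length = S.arity A.rel

/-- `atoms(Q)`: the set of atoms in the body. -/
def Query.atoms (Q : Query) : Finset Atom := Q.body.toFinset

/-- `var(Q)`: the variables that occur in `Q`, in its head or in its body. -/
def Query.vars (Q : Query) : Set ℕ := varsOf Q.head ∪ ⋃ A ∈ Q.atoms, A.vars

/-- The answer of `Q` on `DB`: all tuples `uθ` for substitutions `θ : var(Q) → U` that send every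
body atom to a fact of `DB`. (The values of `θ` outside `var(Q)` are irrelevant.) -/
def Query.answer (Q : Query) (DB : Database) : Set (List ℕ) :=
  {t | ∃ θ : ℕ → ℕ, (∀ x ∈ Q.vars, θ x ∈ DB.dom) ∧
    (∀ A ∈ Q.atoms, A.subst θ ∈ DB.facts) ∧ t = Q.head.map (Term.subst θ)}

/-! ### Hypertree decompositions -/

/-- A finite rooted tree, whose vertices `0, …, n` are labelled by a finite set `χ` of variables and
a finite set `λ` of atoms. The root is `0`, and the vertices are listed in such a way that the
parent of every other vertex precedes it (e.g. in preorder); every finite rooted tree can be listed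
like this. By convention the root is stored as its own parent. -/
structure Hypertree where
  n : ℕ
  parent : Fin (n + 1) → Fin (n + 1)
  parent_root : parent 0 = 0
  parent_lt : ∀ p, p ≠ 0 → parent p < p
  chiList : Fin (n + 1) → List ℕ
  lamList : Fin (n + 1) → List Atom

namespace Hypertree

variable (H : Hypertree)

/-- The vertices of the tree. -/
abbrev Vertex : Type := Fin (H.n + 1)

/-- `χ(p)`. -/
def chi (p : H.Vertex) : Finset ℕ := (H.chiList p).toFinset

/-- `λ(p)`. -/
def lam (p : H.Vertex) : Finset Atom := (H.lamList p).toFinset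

/-- `var(λ(p))`. -/
def lamVars (p : H.Vertex) : Set ℕ := ⋃ A ∈ H.lam p, A.vars

/-- The tree as an undirected graph: the edges join every non-root vertex with its parent. -/
def graph : SimpleGraph H.Vertex :=
  SimpleGraph.fromRel fun p q => H.parent p = q

/-- The vertices of the subtree `T_p` rooted at `p`: all `q` that have `p` as an ancestor
(`p` itself included). -/
def subtree (p : H.Vertex) : Set H.Vertex := {q | ∃ m : ℕ, H.parent^[m] q = p}

/-- The width `max_p |λ(p)|`. -/
def width : ℕ := Finset.univ.sup fun p => (H.lam p).card

/-- `H` is a hypertree for the query `Q`. -/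
def IsHypertreeFor (Q : Query) : Prop :=
  ∀ p, (∀ x ∈ H.chi p, x ∈ Q.vars) ∧ H.lam p ⊆ Q.atoms

/-- `H` is a hypertree decomposition of the query `Q`. -/
structure IsDecomposition (Q : Query) : Prop where
  isHypertree : H.IsHypertreeFor Q
  covers : ∀ A ∈ Q.atoms, ∃ p, A.vars ⊆ H.chi p
  connected : ∀ x ∈ Q.vars, (H.graph.induce {p | x ∈ H.chi p}).Preconnected
  chi_subset : ∀ p, (H.chi p : Set ℕ) ⊆ H.lamVars p
  special : ∀ p, H.lamVars p ∩ (⋃ q ∈ H.subtree p, (H.chi q : Set ℕ)) ⊆ H.chi p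

end Hypertree

/-! ### Encoding over the alphabet `Computability.Γ'` = {blank, 0, 1, bra, ket, comma}

Numbers are written in binary; lists (and records, as lists of their components) are written with
brackets, every component being followed by a comma. -/

/-- The word `[w₁,w₂,…,wₘ,]`. -/
def bracket (ws : List (List Computability.Γ')) : List Computability.Γ' :=
  Computability.Γ'.bra :: (ws.flatMap (fun w => w ++ [Computability.Γ'.comma]) ++
    [Computability.Γ'.ket])

/-- Binary notation. -/
def encodeNumber (n : ℕ) : List Computability.Γ' := (Computability.encodeNat n).map Computability.Γ'.bit

/-- Tuples of numbers. -/
def encodeNums (l : List ℕ) : List Computability.Γ' := bracket (l.map encodeNumber)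

/-- Terms, with a leading tag bit. -/
def encodeTerm : Term → List Computability.Γ'
  | .var x => Computability.Γ'.bit false :: encodeNumber x
  | .const c => Computability.Γ'.bit true :: encodeNumber c

/-- Lists of terms. -/
def encodeTerms (l : List Term) : List Computability.Γ' := bracket (l.map encodeTerm)

/-- Facts. -/
def encodeFact (f : Fact) : List Computability.Γ' := bracket [encodeNumber f.rel, encodeNums f.args]

/-- Atoms. -/
def encodeAtom (A : Atom) : List Computability.Γ' := bracket [encodeNumber A.rel, encodeTerms A.args]

/-- Lists of atoms. -/
def encodeAtoms (l : List Atom) : List Computability.Γ' := bracket (l.map encodeAtom)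

/-- Databases. -/
def encodeDatabase (DB : Database) : List Computability.Γ' :=
  bracket [bracket (DB.facts.map encodeFact), encodeNums DB.dom]

/-- Queries. -/
def encodeQuery (Q : Query) : List Computability.Γ' :=
  bracket [encodeTerms Q.head, encodeAtoms Q.body]

/-- Hypertrees: the list of the vertices `0, …, n`, each with its parent and its two labels. -/
def encodeHypertree (H : Hypertree) : List Computability.Γ' :=
  bracket (List.ofFn fun p : Fin (H.n + 1) =>
    bracket [encodeNumber (H.parent p : ℕ), encodeNums (H.chiList p), encodeAtoms (H.lamList p)])

/-- The input word for the instance `⟨DB, Q, H⟩`; its length is the size of the instance. -/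
def encodeInput (DB : Database) (Q : Query) (H : Hypertree) : List Computability.Γ' :=
  bracket [encodeDatabase DB, encodeQuery Q, encodeHypertree H]

/-- Relations, as lists of tuples. For a list without repetitions, the length of this word is the
size of the relation, whatever the order in which its tuples are listed. -/
def encodeRelation (R : List (List ℕ)) : List Computability.Γ' := bracket (R.map encodeNums)

/-- The list `L` enumerates the relation `R`, without repetitions. -/
def Enumerates (L : List (List ℕ)) (R : Set (List ℕ)) : Prop :=
  L.Nodup ∧ ∀ t, t ∈ L ↔ t ∈ R

end ConjQuery

/-!
Evaluating a query amounts to enumerating the substitutions of its head variables that extend to a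
match of the body. A partial head assignment `σ` is tested for extendability with the
decomposition: at each vertex `p`, the atoms of `λ(p)` are joined and projected to `χ(p)`, keeping
the tuples compatible with `σ`. There are at most `k` atoms, so this relation has polynomial size.
A bottom-up pass of semijoins then removes the tuples that do not extend to the subtree below them.
If a tuple survives at the root, compatible tuples can be chosen top-down, and by connectedness
they glue to a single substitution that satisfies the body.

With this test, `σ` is grown one head term at a time, and only the extendable assignments are kept.
Each of them is a suffix of some answer tuple, so no intermediate result has more elements than the
answer, and the total time is polynomial in the input and the output together.

To obtain a machine, the algorithm is written as a function on finite binary trees. Functions that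
are computed in polynomial time by structured programs over finitely many stacks are closed under
the usual list operations, and such programs compile to multi-stack Turing machines.
-/

/-! ### Structured stack programs and their compilation -/

namespace StackProgram

section Compilation

open Turing

/-- Structured programs over stacks that are indexed by `K` and filled with symbols from `Γ`: the
language in which the machine is written. `case k f` pops stack `k` and continues with the program
that `f` assigns to the popped symbol (`none` for an empty stack); `loop k f` pops `k` and runs
`f x` on the popped symbol `x`, until `k` is found empty. -/
inductive Prog (K Γ : Type) : Type where
  | skip : Prog K Γ
  | push (k : K) (x : Γ) : Prog K Γ
  | seq (p q : Prog K Γ) : Prog K Γ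
  | case (k : K) (f : Option Γ → Prog K Γ) : Prog K Γ
  | loop (k : K) (f : Γ → Prog K Γ) : Prog K Γ

variable {K Γ Λ : Type}

/-- The control points inside a program. -/
def Prog.Label : Prog K Γ → Type
  | .skip => Unit
  | .push _ _ => Unit
  | .seq p q => p.Label ⊕ q.Label
  | .case _ f => Option (Σ o, (f o).Label)
  | .loop _ f => Option (Σ x, (f x).Label)

@[reducible]
noncomputable def Prog.labelFintype [Fintype Γ] : (p : Prog K Γ) → Fintype p.Label
  | .skip => inferInstanceAs (Fintype Unit)
  | .push _ _ => inferInstanceAs (Fintype Unit)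
  | .seq p q =>
    letI := p.labelFintype
    letI := q.labelFintype
    inferInstanceAs (Fintype (p.Label ⊕ q.Label))
  | .case _ f =>
    letI := fun o => (f o).labelFintype
    inferInstanceAs (Fintype (Option (Σ o, (f o).Label)))
  | .loop _ f =>
    letI := fun x => (f x).labelFintype
    inferInstanceAs (Fintype (Option (Σ x, (f x).Label)))

/-- The control point at which the execution of a program starts. -/
def Prog.start : (p : Prog K Γ) → p.Label
  | .skip => ()
  | .push _ _ => ()
  | .seq p _ => .inl p.start
  | .case _ _ => none
  | .loop _ _ => none

/-- The code at the control points of a program that is embedded into a larger machine by `e` and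
continues at `exit` when it has ended. The internal state of the machine holds the symbol that was
popped last. -/
def Prog.code : (p : Prog K Γ) → (p.Label → Λ) → Λ → p.Label →
    TM2.Stmt (fun _ : K => Γ) Λ (Option Γ)
  | .skip, _, exit, _ => .goto fun _ => exit
  | .push k x, _, exit, _ => .push k (fun _ => x) (.goto fun _ => exit)
  | .seq p q, e, exit, l =>
    match l with
    | .inl l => p.code (fun l => e (.inl l)) (e (.inr q.start)) l
    | .inr l => q.code (fun l => e (.inr l)) exit l
  | .case k f, e, exit, l =>
    match l with
    | none => .pop k (fun _ o => o) (.goto fun o => e (some ⟨o, (f o).start⟩))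
    | some ⟨o, l⟩ => (f o).code (fun l => e (some ⟨o, l⟩)) exit l
  | .loop k f, e, exit, l =>
    match l with
    | none => .pop k (fun _ o => o)
        (.goto fun o => o.elim exit fun x => e (some ⟨x, (f x).start⟩))
    | some ⟨x, l⟩ => (f x).code (fun l => e (some ⟨x, l⟩)) (e none) l

@[simp]
theorem Prog.code_start_case (k : K) (f : Option Γ → Prog K Γ) (e : (Prog.case k f).Label → Λ)
    (exit : Λ) : (Prog.case k f).code e exit (Prog.case k f).start =
      .pop k (fun _ o => o) (.goto fun o => e (some ⟨o, (f o).start⟩)) := rfl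

@[simp]
theorem Prog.code_start_loop (k : K) (f : Γ → Prog K Γ) (e : (Prog.loop k f).Label → Λ)
    (exit : Λ) : (Prog.loop k f).code e exit (Prog.loop k f).start =
      .pop k (fun _ o => o) (.goto fun o => o.elim exit fun x => e (some ⟨x, (f x).start⟩)) := rfl

variable [DecidableEq K]

/-- The semantics of programs: started on the stacks `S`, the program ends with the stacks `S'`
after `t` steps of the compiled machine. -/
inductive Exec : Prog K Γ → (S S' : K → List Γ) → (t : ℕ) → Prop where
  | skip (S : K → List Γ) : Exec .skip S S 1
  | push (k : K) (x : Γ) (S : K → List Γ) :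
      Exec (.push k x) S (Function.update S k (x :: S k)) 1
  | seq {p q : Prog K Γ} {S S' S'' : K → List Γ} {t t' : ℕ} :
      Exec p S S' t → Exec q S' S'' t' → Exec (.seq p q) S S'' (t + t')
  | case {k : K} {f : Option Γ → Prog K Γ} {S S' : K → List Γ} {t : ℕ} :
      Exec (f (S k).head?) (Function.update S k (S k).tail) S' t →
      Exec (.case k f) S S' (1 + t)
  | loop_nil {k : K} (f : Γ → Prog K Γ) {S : K → List Γ} :
      S k = [] → Exec (.loop k f) S S 1
  | loop_cons {k : K} {f : Γ → Prog K Γ} {S S' S'' : K → List Γ} {x : Γ} {l : List Γ} {t t' : ℕ} :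
      S k = x :: l → Exec (f x) (Function.update S k l) S' t → Exec (.loop k f) S' S'' t' →
      Exec (.loop k f) S S'' (1 + (t + t'))

theorem Exec.iterate_step {m : Λ → TM2.Stmt (fun _ : K => Γ) Λ (Option Γ)}
    {p : Prog K Γ} {S S' : K → List Γ} {t : ℕ} (h : Exec p S S' t) {e : p.Label → Λ} {exit : Λ}
    (he : ∀ l, m (e l) = p.code e exit l) (v : Option Γ) :
    ∃ v', (flip bind (TM2.step m))^[t] (some ⟨some (e p.start), v, S⟩) =
      some ⟨some exit, v', S'⟩ := by
  induction h generalizing exit v with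
  | skip S => exact ⟨v, by simp [flip, he, Prog.code]⟩
  | push k x S => exact ⟨v, by simp [flip, he, Prog.code]⟩
  | @seq p q S S' S'' t t' _ _ ih₁ ih₂ =>
    obtain ⟨v₁, h₁⟩ := ih₁ (e := fun l => e (.inl l)) (fun l => he (.inl l)) v
    obtain ⟨v₂, h₂⟩ := ih₂ (e := fun l => e (.inr l)) (fun l => he (.inr l)) v₁
    refine ⟨v₂, ?_⟩
    rw [Nat.add_comm, Function.iterate_add_apply, ← h₂, ← h₁]
    rfl
  | @case k f S S' t _ ih =>
    obtain ⟨v₁, h₁⟩ := ih (e := fun l => e (some ⟨_, l⟩)) (fun l => he (some ⟨_, l⟩)) (S k).head?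
    refine ⟨v₁, ?_⟩
    rw [Nat.add_comm, Function.iterate_add_apply, ← h₁]
    simp [flip, he]
  | @loop_nil k f S hS =>
    have hupdate : Function.update S k [] = S := by rw [← hS, Function.update_eq_self]
    exact ⟨none, by simp [flip, he, hS, hupdate]⟩
  | @loop_cons k f S S' S'' x l t t' hS _ _ ih₁ ih₂ =>
    obtain ⟨v₁, h₁⟩ := ih₁ (e := fun l => e (some ⟨x, l⟩)) (fun l => he (some ⟨_, l⟩)) (some x)
    obtain ⟨v₂, h₂⟩ := ih₂ he v₁
    refine ⟨v₂, ?_⟩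
    rw [Nat.add_comm, Function.iterate_add_apply, Nat.add_comm t t', Function.iterate_add_apply,
      ← h₂]
    refine congrArg _ (Eq.trans ?_ h₁)
    simp [flip, he, hS]

/-- The machine that runs `p`, with input on stack `k₀` and output on stack `k₁`. The label `none`
stands for the end of `p`: there the internal state is reset, as a final configuration requires. -/
noncomputable def Prog.toFinTM2 [Fintype K] [Fintype Γ] (p : Prog K Γ) (k₀ k₁ : K) : FinTM2 where
  K := K
  k₀ := k₀
  k₁ := k₁
  Γ _ := Γ
  Λ := Option p.Label
  main := some p.start
  ΛFin := letI := p.labelFintype; inferInstance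
  σ := Option Γ
  initialState := none
  m l := l.elim (.load (fun _ => none) .halt) (p.code some none)

theorem Exec.outputsInTime [Fintype K] [Fintype Γ] {p : Prog K Γ} {k₀ k₁ : K} {v w : List Γ}
    {t n : ℕ} (h : Exec p (fun k => if k = k₀ then v else []) (fun k => if k = k₁ then w else []) t)
    (hn : t + 1 ≤ n) : Nonempty (TM2OutputsInTime (p.toFinTM2 k₀ k₁) v (some w) n) := by
  obtain ⟨o, ho⟩ := h.iterate_step (Λ := Option p.Label) (m := (p.toFinTM2 k₀ k₁).m)
    (e := some) (exit := none) (fun _ => rfl) none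
  refine ⟨⟨⟨t + 1, ?_⟩, hn⟩⟩
  have hinit : initList (p.toFinTM2 k₀ k₁) v =
      (⟨some (some p.start), none, fun k => if k = k₀ then v else []⟩ :
        TM2.Cfg (fun _ : K => Γ) (Option p.Label) (Option Γ)) := by
    unfold initList
    congr 1
  have hhalt : haltList (p.toFinTM2 k₀ k₁) w =
      (⟨none, none, fun k => if k = k₁ then w else []⟩ :
        TM2.Cfg (fun _ : K => Γ) (Option p.Label) (Option Γ)) := by
    unfold haltList
    congr 1
  change _ = some (haltList (p.toFinTM2 k₀ k₁) w)
  rw [Nat.add_comm, Function.iterate_add_apply, hinit, hhalt]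
  exact (congrArg _ ho).trans rfl

end Compilation

section Runs

variable {K Γ : Type} [DecidableEq K] {k k' : K} {p q : Prog K Γ} {S S' S'' : K → List Γ}
  {n n' : ℕ}

/-- `p` leads from the stacks `S` to the stacks `S'` in at most `n` steps. -/
def Runs (p : Prog K Γ) (S S' : K → List Γ) (n : ℕ) : Prop := ∃ t ≤ n, Exec p S S' t

theorem Runs.mono (h : Runs p S S' n) (hn : n ≤ n') : Runs p S S' n' := by
  obtain ⟨t, ht, h⟩ := h
  exact ⟨t, ht.trans hn, h⟩

theorem Runs.skip (S : K → List Γ) : Runs .skip S S 1 := ⟨1, le_rfl, .skip S⟩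

theorem Runs.push (k : K) (x : Γ) (S : K → List Γ) :
    Runs (.push k x) S (Function.update S k (x :: S k)) 1 := ⟨1, le_rfl, .push k x S⟩

theorem Runs.seq (h : Runs p S S' n) (h' : Runs q S' S'' n') :
    Runs (.seq p q) S S'' (n + n') := by
  obtain ⟨t, ht, h⟩ := h
  obtain ⟨t', ht', h'⟩ := h'
  exact ⟨t + t', by lia, h.seq h'⟩

theorem Runs.case {f : Option Γ → Prog K Γ}
    (h : Runs (f (S k).head?) (Function.update S k (S k).tail) S' n) :
    Runs (.case k f) S S' (1 + n) := by
  obtain ⟨t, ht, h⟩ := h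
  exact ⟨1 + t, by lia, h.case⟩

theorem Runs.loop_nil (f : Γ → Prog K Γ) (h : S k = []) : Runs (.loop k f) S S 1 :=
  ⟨1, le_rfl, .loop_nil f h⟩

theorem Runs.loop_cons {f : Γ → Prog K Γ} {x : Γ} {l : List Γ} (hS : S k = x :: l)
    (h : Runs (f x) (Function.update S k l) S' n) (h' : Runs (.loop k f) S' S'' n') :
    Runs (.loop k f) S S'' (1 + (n + n')) := by
  obtain ⟨t, ht, h⟩ := h
  obtain ⟨t', ht', h'⟩ := h'
  exact ⟨1 + (t + t'), by lia, .loop_cons hS h h'⟩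

/-- Moves the contents of stack `k` to stack `k'`, in reverse. -/
def pour (k k' : K) : Prog K Γ := .loop k fun x => .push k' x

theorem runs_pour (hk : k ≠ k') (S : K → List Γ) :
    Runs (pour k k') S (Function.update (Function.update S k []) k' ((S k).reverse ++ S k'))
      (2 * (S k).length + 1) := by
  generalize hw : S k = w
  induction w generalizing S with
  | nil =>
    have hS : Function.update S k [] = S := by rw [← hw, Function.update_eq_self]
    simpa [hS, pour] using Runs.loop_nil _ hw
  | cons x w ih =>
    have h := ih (Function.update (Function.update S k w) k' (x :: S k'))
      (by simp [Function.update_of_ne hk])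
    refine (Runs.loop_cons hw (.push k' x _) ?_).mono (n := 1 + (1 + (2 * w.length + 1)))
      (by simp only [List.length_cons]; lia)
    rw [Function.update_of_ne hk.symm]
    convert h using 1
    · rfl
    funext j
    by_cases h₁ : j = k <;> by_cases h₂ : j = k' <;> simp_all

/-- Empties stack `k`. -/
def drain (k : K) : Prog K Γ := .loop k fun _ => .skip

theorem runs_drain (k : K) (S : K → List Γ) :
    Runs (drain k) S (Function.update S k []) (2 * (S k).length + 1) := by
  generalize hw : S k = w
  induction w generalizing S with
  | nil =>
    have hS : Function.update S k [] = S := by rw [← hw, Function.update_eq_self]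
    simpa [hS, drain] using Runs.loop_nil _ hw
  | cons x w ih =>
    have h := ih (Function.update S k w) (by simp)
    rw [Function.update_idem] at h
    exact (Runs.loop_cons hw (.skip _) h).mono (by simp only [List.length_cons]; lia)

end Runs

/-! ### Operations on coded trees -/

/-- Binary trees, the data manipulated by the programs. -/
inductive Data where
  | nil
  | node (x y : Data)
deriving DecidableEq

/-- The stack symbols. Those other than `zero` and `one` occur only in input and output words. -/
abbrev Sym : Type := Computability.Γ'

/-- The symbol that codes a leaf. -/
abbrev zero : Sym := .bit false

/-- The symbol that starts the code of an inner node. -/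
abbrev one : Sym := .bit true

/-- The prefix code of a tree. -/
def Data.code : Data → List Sym
  | .nil => [zero]
  | .node x y => one :: (x.code ++ y.code)

/-- The number of vertices, inner vertices and leaves; this is the length of the code. -/
def Data.size : Data → ℕ
  | .nil => 1
  | .node x y => x.size + y.size + 1

@[simp] theorem Data.length_code (x : Data) : x.code.length = x.size := by
  induction x with
  | nil => rfl
  | node x y ihx ihy => simp [code, size, ihx, ihy]

theorem Data.code_append_inj {x y : Data} {u v : List Sym} (h : x.code ++ u = y.code ++ v) :
    x = y ∧ u = v := by
  induction x generalizing y u v with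
  | nil => cases y <;> simp_all [code]
  | node x₁ x₂ ih₁ ih₂ =>
    cases y with
    | nil => simp [code] at h
    | node y₁ y₂ =>
      simp only [code, List.cons_append, List.cons.injEq, true_and, List.append_assoc] at h
      obtain ⟨rfl, h'⟩ := ih₁ h
      obtain ⟨rfl, rfl⟩ := ih₂ h'
      exact ⟨rfl, rfl⟩

/-- The stacks of the tree programs: `main` holds the codes of the trees that are being
manipulated, the others are scratch space. -/
inductive Reg where
  | main | a | b | c
deriving DecidableEq

instance : Fintype Reg := ⟨{.main, .a, .b, .c}, fun k => by cases k <;> decide⟩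

/-- The contents of the four stacks, in the order `main`, `a`, `b`, `c`. -/
def regs (m a b c : List Sym) : Reg → List Sym
  | .main => m
  | .a => a
  | .b => b
  | .c => c

section Regs

variable (m a b c l : List Sym)

@[simp] theorem regs_main : regs m a b c .main = m := rfl

@[simp] theorem regs_a : regs m a b c .a = a := rfl

@[simp] theorem regs_b : regs m a b c .b = b := rfl

@[simp] theorem regs_c : regs m a b c .c = c := rfl

@[simp] theorem update_regs_main :
    Function.update (regs m a b c) .main l = regs l a b c := by
  funext k; cases k <;> rfl

@[simp] theorem update_regs_a : Function.update (regs m a b c) .a l = regs m l b c := by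
  funext k; cases k <;> rfl

@[simp] theorem update_regs_b : Function.update (regs m a b c) .b l = regs m a l c := by
  funext k; cases k <;> rfl

@[simp] theorem update_regs_c : Function.update (regs m a b c) .c l = regs m a b l := by
  funext k; cases k <;> rfl

end Regs

/-- The stacks between two operations on trees: all scratch stacks are empty. -/
abbrev onMain (m : List Sym) : Reg → List Sym := regs m [] [] []

/-- Moves as many trees from `main` to `a`, in reverse, as there are symbols on `c`. -/
def grabLoop : Prog Reg Sym :=
  .loop .c fun _ => .case .main fun o =>
    if o = some one then .seq (.push .a one) (.seq (.push .c one) (.push .c one))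
    else .push .a zero

theorem runs_grabLoop {m a b c : List Sym} {S : Reg → List Sym} {n : ℕ} (x : Data)
    (h : Runs grabLoop (regs m (x.code.reverse ++ a) b c) S n) :
    Runs grabLoop (regs (x.code ++ m) a b (one :: c)) S (5 * x.size + n) := by
  induction x generalizing m a c n with
  | nil =>
    refine Runs.mono (.loop_cons rfl (.case ?_) h) (n := 1 + (1 + 1 + n))
      (by simp only [Data.size]; lia)
    simpa [Data.code] using Runs.push .a zero (regs m a b c)
  | node x y ihx ihy =>
    have hchildren := ihx (m := y.code ++ m) (a := one :: a) (c := one :: c)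
      (ihy (by simpa [Data.code] using h))
    refine Runs.mono (.loop_cons rfl (.case ?_) hchildren)
      (n := 1 + (1 + 3 + (5 * x.size + (5 * y.size + n)))) (by simp only [Data.size]; lia)
    simpa [Data.code] using (Runs.push .a one (regs (x.code ++ (y.code ++ m)) a b c)).seq
      ((Runs.push Reg.c one _).seq (Runs.push Reg.c one _))

/-- Moves the tree on top of `main` to the stack `a`, in reverse. -/
def grab : Prog Reg Sym := .seq (.push .c one) grabLoop

theorem runs_grab (x : Data) (m b : List Sym) :
    Runs grab (regs (x.code ++ m) [] b []) (regs m x.code.reverse b []) (5 * x.size + 2) := by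
  have h := runs_grabLoop x (m := m) (a := []) (b := b) (c := []) (.loop_nil _ rfl)
  exact .mono (.seq (.push Reg.c one _) (by simpa using h)) (by lia)

/-- Removes the tree on top. -/
def dropTop : Prog Reg Sym := .seq grab (drain .a)

theorem runs_dropTop (x : Data) (m b : List Sym) :
    Runs dropTop (regs (x.code ++ m) [] b []) (regs m [] b []) (7 * x.size + 3) := by
  refine ((runs_grab x m b).seq ?_).mono (n := 5 * x.size + 2 + (2 * x.size + 1)) (by lia)
  simpa using runs_drain .a (regs m x.code.reverse b [])

/-- Puts the tree on top aside, runs `p`, and exchanges the tree that is then on top with the one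
that was put aside. -/
def swapAfter (p : Prog Reg Sym) : Prog Reg Sym :=
  .seq grab <| .seq (pour .a .b) <| .seq p <| .seq grab <| .seq (pour .b .c) <|
    .seq (pour .c .main) (pour .a .main)

theorem runs_swapAfter {p : Prog Reg Sym} {x y : Data} {m m' : List Sym} {n : ℕ}
    (h : Runs p (regs m [] x.code []) (regs (y.code ++ m') [] x.code []) n) :
    Runs (swapAfter p) (onMain (x.code ++ m)) (onMain (y.code ++ (x.code ++ m')))
      (11 * (x.size + y.size) + 8 + n) := by
  have grab_x := runs_grab x m []
  have pour_x := runs_pour (k := .a) (k' := .b) (by simp) (regs m x.code.reverse [] [])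
  have grab_y := runs_grab y m' x.code
  have pour_x' := runs_pour (k := .b) (k' := .c) (by simp) (regs m' y.code.reverse x.code [])
  have restore_x := runs_pour (k := .c) (k' := .main) (by simp)
    (regs m' y.code.reverse [] x.code.reverse)
  have restore_y := runs_pour (k := .a) (k' := .main) (by simp)
    (regs (x.code ++ m') y.code.reverse [] [])
  simp only [update_regs_main, update_regs_a, update_regs_b, update_regs_c, regs_main,
    regs_a, regs_b, regs_c, List.reverse_reverse, List.append_nil, List.length_reverse,
    Data.length_code] at grab_x pour_x grab_y pour_x' restore_x restore_y
  exact (grab_x.seq (pour_x.seq (h.seq (grab_y.seq (pour_x'.seq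
    (restore_x.seq restore_y)))))).mono (by lia)

/-- Exchanges the two trees on top. -/
def swapTop : Prog Reg Sym := swapAfter .skip

theorem runs_swapTop (x y : Data) (m : List Sym) :
    Runs swapTop (onMain (x.code ++ (y.code ++ m))) (onMain (y.code ++ (x.code ++ m)))
      (11 * (x.size + y.size) + 9) :=
  runs_swapAfter (.skip _)

/-- Joins the two trees below the top, and exchanges the result with the top. -/
def consBelow : Prog Reg Sym := swapAfter (.push .main one)

theorem runs_consBelow (x y z : Data) (m : List Sym) :
    Runs consBelow (onMain (x.code ++ (y.code ++ (z.code ++ m))))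
      (onMain ((Data.node y z).code ++ (x.code ++ m))) (11 * (x.size + y.size + z.size) + 20) := by
  have h := runs_swapAfter (x := x) (y := .node y z) (m' := m) (n := 1)
    (by simpa [Data.code] using Runs.push .main one (regs (y.code ++ (z.code ++ m)) [] x.code []))
  exact h.mono (by simp only [Data.size]; lia)

theorem runs_copyLoop (w m b c : List Sym) :
    Runs (.loop .a fun x => .seq (.push .main x) (.push .b x)) (regs m w b c)
      (regs (w.reverse ++ m) [] (w.reverse ++ b) c) (3 * w.length + 1) := by
  induction w generalizing m b with
  | nil => exact .loop_nil _ rfl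
  | cons x w ih =>
    refine .mono (.loop_cons rfl (.seq (.push Reg.main x _) (.push Reg.b x _))
      (n' := 3 * w.length + 1) ?_) (by simp only [List.length_cons]; lia)
    simpa using ih (x :: m) (x :: b)

/-- Duplicates the tree on top. -/
def dupTop : Prog Reg Sym :=
  .seq grab <| .seq (.loop .a fun x => .seq (.push .main x) (.push .b x)) <|
    .seq (pour .b .a) (pour .a .main)

theorem runs_dupTop (x : Data) (m : List Sym) :
    Runs dupTop (onMain (x.code ++ m)) (onMain (x.code ++ (x.code ++ m))) (12 * x.size + 5) := by
  have grab_x := runs_grab x m []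
  have copy_x := runs_copyLoop x.code.reverse m [] []
  have reverse_x := runs_pour (k := .b) (k' := .a) (by simp) (regs (x.code ++ m) [] x.code [])
  have restore_x := runs_pour (k := .a) (k' := .main) (by simp)
    (regs (x.code ++ m) x.code.reverse [] [])
  simp only [update_regs_main, update_regs_a, update_regs_b, regs_main, regs_a, regs_b,
    List.reverse_reverse, List.append_nil, List.length_reverse, Data.length_code]
    at grab_x copy_x reverse_x restore_x
  exact (grab_x.seq (copy_x.seq (reverse_x.seq restore_x))).mono (by lia)

/-- Puts a leaf on top. -/
def pushNil : Prog Reg Sym := .push .main zero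

theorem runs_pushNil (m b : List Sym) :
    Runs pushNil (regs m [] b []) (regs (Data.nil.code ++ m) [] b []) 1 := by
  simpa [Data.code, pushNil] using Runs.push .main zero (regs m [] b [])

/-- Joins the two trees on top. -/
def consTop : Prog Reg Sym := .push .main one

theorem runs_consTop (x y : Data) (m b : List Sym) :
    Runs consTop (regs (x.code ++ (y.code ++ m)) [] b [])
      (regs ((Data.node x y).code ++ m) [] b []) 1 := by
  simpa [Data.code, consTop] using Runs.push .main one (regs (x.code ++ (y.code ++ m)) [] b [])

/-- Removes a leaf from the top and runs `p`, or replaces a node by its children and runs `q`. -/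
def caseTop (p q : Prog Reg Sym) : Prog Reg Sym :=
  .case .main fun o => if o = some one then q else p

theorem runs_caseTop_nil {p q : Prog Reg Sym} {m b : List Sym} {S : Reg → List Sym} {n : ℕ}
    (h : Runs p (regs m [] b []) S n) :
    Runs (caseTop p q) (regs (Data.nil.code ++ m) [] b []) S (1 + n) :=
  .case (by simpa [Data.code] using h)

theorem runs_caseTop_node {p q : Prog Reg Sym} {x y : Data} {m b : List Sym}
    {S : Reg → List Sym} {n : ℕ} (h : Runs q (regs (x.code ++ (y.code ++ m)) [] b []) S n) :
    Runs (caseTop p q) (regs ((Data.node x y).code ++ m) [] b []) S (1 + n) :=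
  .case (by simpa [Data.code] using h)

/-- The loop of `whileTop`: there is a symbol on `c` as long as the loop is to be continued. -/
def whileLoop (p : Prog Reg Sym) : Prog Reg Sym :=
  .loop .c fun _ => caseTop .skip (.seq p (.push .c one))

theorem runs_whileLoop_nil (p : Prog Reg Sym) (m b : List Sym) :
    Runs (whileLoop p) (regs (Data.nil.code ++ m) [] b [one]) (regs m [] b []) 4 :=
  .mono (.loop_cons (n := 2) rfl (by simpa using runs_caseTop_nil (.skip _)) (.loop_nil _ rfl))
    (by lia)

theorem runs_whileLoop_node {p : Prog Reg Sym} {x y : Data} {m m' b b' : List Sym}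
    {S : Reg → List Sym} {n n' : ℕ}
    (h : Runs p (regs (x.code ++ (y.code ++ m)) [] b []) (regs m' [] b' []) n)
    (h' : Runs (whileLoop p) (regs m' [] b' [one]) S n') :
    Runs (whileLoop p) (regs ((Data.node x y).code ++ m) [] b [one]) S (n + 3 + n') := by
  have hbody := runs_caseTop_node (p := .skip) (h.seq (Runs.push Reg.c one _))
  exact .mono (.loop_cons (n := 1 + (n + 1)) rfl (by simpa using hbody) h') (by lia)

/-- As long as the top is a node, replaces it by its children and runs `p`; finally removes the
leaf. -/
def whileTop (p : Prog Reg Sym) : Prog Reg Sym := .seq (.push .c one) (whileLoop p)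

theorem runs_whileTop {p : Prog Reg Sym} {m b : List Sym} {S : Reg → List Sym} {n : ℕ}
    (h : Runs (whileLoop p) (regs m [] b [one]) S n) :
    Runs (whileTop p) (regs m [] b []) S (1 + n) :=
  .seq (.push Reg.c one _) (by simpa using h)

/-- Compares the contents of `b` with those of `c`, and leaves a symbol on `a` for every
mismatch. -/
def compareLoop : Prog Reg Sym :=
  .loop .b fun x => .case .c fun o => if o = some x then .skip else .push .a one

theorem exists_runs_compareLoop (m w a c : List Sym) : ∃ a' c' : List Sym,
    Runs compareLoop (regs m a w c) (regs m a' [] c') (3 * w.length + 1) ∧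
      (a' = [] ↔ a = [] ∧ w <+: c) ∧ a'.length ≤ a.length + w.length ∧ c'.length ≤ c.length := by
  induction w generalizing a c with
  | nil => exact ⟨a, c, .loop_nil _ rfl, by simp, by simp, le_rfl⟩
  | cons x w ih =>
    by_cases hc : c.head? = some x
    · obtain ⟨c, rfl⟩ := List.head?_eq_some_iff.1 hc
      obtain ⟨a', c', hruns, hnil, ha', hc'⟩ := ih a c
      refine ⟨a', c', .mono (.loop_cons (n := 2) rfl (.case (S' := regs m a w c) (n := 1) ?_)
        hruns) ?_, by simp [hnil], ?_, ?_⟩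
      · simpa using Runs.skip (regs m a w c)
      all_goals simp only [List.length_cons]; lia
    · obtain ⟨a', c', hruns, hnil, ha', hc'⟩ := ih (one :: a) c.tail
      have hprefix : ¬ x :: w <+: c := fun ⟨v, hv⟩ => hc (by simp [← hv])
      refine ⟨a', c', .mono (.loop_cons (n := 2) rfl
        (.case (S' := regs m (one :: a) w c.tail) (n := 1) ?_) hruns) ?_,
        by simp [hnil, hprefix], ?_, ?_⟩
      · simpa [hc] using Runs.push .a one (regs m a w c.tail)
      all_goals simp only [List.length_cons, List.length_tail] at ha' hc' ⊢; lia

/-- Truth values as trees. -/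
def boolData (b : Bool) : Data := if b then .node .nil .nil else .nil

/-- Empties `a`, and puts the truth value of whether it was empty on top. -/
def emptyTest : Prog Reg Sym :=
  .case .a fun o =>
    if o = none then .seq pushNil (.seq pushNil consTop) else .seq (drain .a) pushNil

theorem runs_emptyTest (m a : List Sym) :
    Runs emptyTest (regs m a [] []) (onMain ((boolData a.isEmpty).code ++ m))
      (2 * a.length + 4) := by
  cases a with
  | nil =>
    have htrue := (runs_pushNil m []).seq ((runs_pushNil _ []).seq
      (runs_consTop .nil .nil m []))
    exact .mono (.case (n := 3) (by simpa [boolData] using htrue)) (by lia)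
  | cons s a =>
    have hdrain := runs_drain .a (regs m a [] [])
    simp only [update_regs_a, regs_a] at hdrain
    have hfalse := hdrain.seq (runs_pushNil m [])
    exact .mono (.case (by simpa [boolData] using hfalse)) (by simp only [List.length_cons]; lia)

/-- Replaces the two trees on top by the truth value of their equality. -/
def eqTop : Prog Reg Sym :=
  .seq grab <| .seq (pour .a .b) <| .seq grab <| .seq (pour .a .c) <|
    .seq compareLoop <| .seq (drain .c) emptyTest

theorem runs_eqTop (x y : Data) (m : List Sym) :
    Runs eqTop (onMain (x.code ++ (y.code ++ m))) (onMain ((boolData (decide (x = y))).code ++ m))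
      (20 * (x.size + y.size) + 20) := by
  have grab_x := runs_grab x (y.code ++ m) []
  have pour_x := runs_pour (k := .a) (k' := .b) (by simp)
    (regs (y.code ++ m) x.code.reverse [] [])
  have grab_y := runs_grab y m x.code
  have pour_y := runs_pour (k := .a) (k' := .c) (by simp) (regs m y.code.reverse x.code [])
  obtain ⟨a, c, hcompare, hnil, ha, hc⟩ := exists_runs_compareLoop m x.code [] y.code
  have hdrain := runs_drain .c (regs m a [] c)
  simp only [update_regs_a, update_regs_b, update_regs_c, regs_a, regs_b, regs_c,
    List.reverse_reverse, List.append_nil, List.length_reverse, Data.length_code, true_and,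
    List.length_nil, zero_add] at grab_x pour_x grab_y pour_y hcompare hdrain hnil ha hc
  have heq : a.isEmpty = decide (x = y) := by
    rw [Bool.eq_iff_iff, List.isEmpty_iff, hnil, decide_eq_true_iff]
    refine ⟨fun ⟨u, hu⟩ => ?_, fun h => h ▸ List.prefix_rfl⟩
    exact (Data.code_append_inj (hu.trans (List.append_nil _).symm)).1
  have htest := runs_emptyTest m a
  rw [heq] at htest
  exact (grab_x.seq (pour_x.seq (grab_y.seq (pour_y.seq
    (hcompare.seq (hdrain.seq htest)))))).mono (by lia)

end StackProgram

/-! ### Polynomial-time functions on structured data -/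

namespace StackProgram

/-- Types whose elements are represented by trees, together with the measure of their elements in
terms of which running times are bounded. The weight may exceed the size of the tree: it can charge
for information that is not part of the tree, such as the size of the result that is to be
computed. -/
class Coded (α : Type) where
  encode : α → Data
  weight : α → ℕ
  size_encode_le : ∀ a, (encode a).size ≤ weight a

open Coded

instance : Coded Data := ⟨id, Data.size, fun _ => le_rfl⟩

instance : Coded Bool := ⟨boolData, fun b => (boolData b).size, fun _ => le_rfl⟩

instance {α : Type} [Coded α] : Coded (List α) where
  encode := List.foldr (fun x t => .node (encode x) t) .nil
  weight := List.foldr (fun x n => weight x + n + 1) 1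
  size_encode_le l := by
    induction l with
    | nil => simp [Data.size]
    | cons x l ih => simpa [Data.size] using add_le_add (size_encode_le x) ih

instance {α β : Type} [Coded α] [Coded β] : Coded (α × β) where
  encode p := .node (encode p.1) (encode p.2)
  weight p := weight p.1 + weight p.2 + 1
  size_encode_le p := by
    simpa [Data.size] using add_le_add (size_encode_le p.1) (size_encode_le p.2)

section Weight

variable {α β : Type} [Coded α] [Coded β]

@[simp] theorem encode_nil : encode ([] : List α) = .nil := rfl

@[simp] theorem encode_cons (x : α) (l : List α) :
    encode (x :: l) = .node (encode x) (encode l) := rfl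

@[simp] theorem encode_prod (p : α × β) : encode p = .node (encode p.1) (encode p.2) := rfl

theorem weight_bool_le (b : Bool) : weight b ≤ 3 := by cases b <;> decide

@[simp] theorem weight_nil : weight ([] : List α) = 1 := rfl

@[simp] theorem weight_cons (x : α) (l : List α) : weight (x :: l) = weight x + weight l + 1 := rfl

@[simp] theorem weight_prod (p : α × β) : weight p = weight p.1 + weight p.2 + 1 := rfl

theorem weight_append (l l' : List α) : weight (l ++ l') + 1 = weight l + weight l' := by
  induction l with
  | nil => simp only [List.nil_append, weight_nil]; lia
  | cons x l ih => simp only [List.cons_append, weight_cons]; lia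

theorem length_lt_weight (l : List α) : l.length < weight l := by
  induction l with
  | nil => simp
  | cons x l ih => simp only [List.length_cons, weight_cons]; lia

theorem weight_le_of_sublist {l l' : List α} (h : l.Sublist l') : weight l ≤ weight l' := by
  induction h with
  | slnil => exact le_rfl
  | cons _ _ ih => rw [weight_cons]; lia
  | cons_cons _ _ ih => simp only [weight_cons]; lia

theorem weight_le_of_mem {x : α} {l : List α} (h : x ∈ l) : weight x ≤ weight l := by
  have := weight_le_of_sublist (List.singleton_sublist.2 h)
  simp only [weight_cons] at this
  lia

theorem weight_le_of_forall_mem {l : List α} {n : ℕ} (h : ∀ x ∈ l, weight x ≤ n) :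
    weight l ≤ l.length * (n + 1) + 1 := by
  induction l with
  | nil => simp
  | cons x l ih =>
    have hx := h x (by simp)
    have hl := ih fun y hy => h y (by simp [hy])
    simp only [weight_cons, List.length_cons, add_mul, one_mul] at hl ⊢
    lia

theorem weight_foldl_le {β γ : Type} [Coded γ] {step : γ → β → γ} {l : List β} {n : ℕ}
    (h : ∀ s, ∀ x ∈ l, weight (step s x) ≤ weight s + n) (s : γ) :
    weight (l.foldl step s) ≤ weight s + l.length * n := by
  induction l generalizing s with
  | nil => simp
  | cons x l ih =>
    have hx := h s x (by simp)
    have hl := ih (fun s y hy => h s y (by simp [hy])) (step s x)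
    simp only [List.foldl_cons, List.length_cons, add_mul, one_mul]
    lia

end Weight

theorem eval_mono {R : Type*} [CommSemiring R] [PartialOrder R] [CanonicallyOrderedAdd R]
    [IsOrderedRing R] (q : Polynomial R) {a b : R} (h : a ≤ b) : q.eval a ≤ q.eval b := by
  simp only [Polynomial.eval_eq_sum, Polynomial.sum_def]
  gcongr

/-- Functions that some program computes in time polynomial in the weight of the argument, with
values of polynomially bounded weight. -/
@[fun_prop]
def PolyTime {α β : Type} [Coded α] [Coded β] (f : α → β) : Prop :=
  ∃ (p : Prog Reg Sym) (q : Polynomial ℕ), (∀ a, weight (f a) ≤ q.eval (weight a)) ∧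
    ∀ a m, Runs p (onMain ((encode a).code ++ m)) (onMain ((encode (f a)).code ++ m))
      (q.eval (weight a))

variable {α β γ δ : Type} [Coded α] [Coded β] [Coded γ] [Coded δ]

open Polynomial (X C)

theorem PolyTime.intro {f : α → β} (p : Prog Reg Sym) (q q' : Polynomial ℕ)
    (hq : ∀ a, weight (f a) ≤ q.eval (weight a))
    (hp : ∀ a m, Runs p (onMain ((encode a).code ++ m)) (onMain ((encode (f a)).code ++ m))
      (q'.eval (weight a))) : PolyTime f := by
  refine ⟨p, q + q', fun a => ?_, fun a m => (hp a m).mono ?_⟩ <;> rw [Polynomial.eval_add]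
  · exact (hq a).trans (Nat.le_add_right _ _)
  · exact Nat.le_add_left _ _

theorem PolyTime.exists_weight_le {f : α → β} (hf : PolyTime f) :
    ∃ q : Polynomial ℕ, ∀ a, weight (f a) ≤ q.eval (weight a) := by
  obtain ⟨_, q, hq, _⟩ := hf
  exact ⟨q, hq⟩

theorem PolyTime.congr_encode {f : α → β} {g : α → γ} (hf : PolyTime f)
    (h : ∀ a, encode (g a) = encode (f a)) (q : Polynomial ℕ)
    (hq : ∀ a, weight (g a) ≤ q.eval (weight a)) : PolyTime g := by
  obtain ⟨p, q', _, hp⟩ := hf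
  exact .intro p q q' hq fun a m => by rw [h]; exact hp a m

@[fun_prop]
theorem PolyTime.id : PolyTime fun a : α => a :=
  .intro .skip X 1 (fun a => by simp) fun a m => by simpa using Runs.skip _

@[fun_prop]
theorem PolyTime.comp {g : β → γ} {f : α → β} (hg : PolyTime g) (hf : PolyTime f) :
    PolyTime fun a => g (f a) := by
  obtain ⟨p, q, hq, hp⟩ := hf
  obtain ⟨p', q', hq', hp'⟩ := hg
  refine .intro (.seq p p') (q'.comp q) (q + q'.comp q) (fun a => ?_) fun a m => ?_ <;>
    simp only [Polynomial.eval_add, Polynomial.eval_comp]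
  · exact (hq' _).trans (eval_mono _ (hq a))
  · exact (hp a m).seq ((hp' _ m).mono (eval_mono _ (hq a)))

/-- Puts a given tree on top. -/
def pushData : Data → Prog Reg Sym
  | .nil => pushNil
  | .node x y => .seq (pushData y) (.seq (pushData x) consTop)

theorem runs_pushData (x : Data) (m b : List Sym) :
    Runs (pushData x) (regs m [] b []) (regs (x.code ++ m) [] b []) (2 * x.size) := by
  induction x generalizing m with
  | nil => exact (runs_pushNil m b).mono (by simp [Data.size])
  | node x y ihx ihy =>
    exact ((ihy m).seq ((ihx _).seq (runs_consTop x y m b))).mono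
      (by simp only [Data.size]; lia)

@[fun_prop]
theorem PolyTime.const (b : β) : PolyTime fun _ : α => b := by
  refine .intro (.seq dropTop (pushData (encode b))) (C (weight b))
    (7 * X + C (3 + 2 * (encode b).size)) (by simp) fun a m => ?_
  refine ((runs_dropTop (encode a) m []).seq (runs_pushData (encode b) m [])).mono ?_
  have := size_encode_le a
  simp only [Polynomial.eval_add, Polynomial.eval_mul, Polynomial.eval_X, Polynomial.eval_C,
    Polynomial.eval_ofNat]
  lia

@[fun_prop]
theorem PolyTime.fst : PolyTime fun p : α × β => p.1 := by
  refine .intro (caseTop .skip (.seq swapTop dropTop)) X (30 * X + 20)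
    (fun p => by simp [add_assoc]) fun p m => ?_
  refine (runs_caseTop_node ((runs_swapTop (encode p.1) (encode p.2) m).seq
    (runs_dropTop (encode p.2) _ []))).mono ?_
  have := size_encode_le p.1
  have := size_encode_le p.2
  simp only [Polynomial.eval_add, Polynomial.eval_mul, Polynomial.eval_X, Polynomial.eval_ofNat,
    weight_prod]
  lia

@[fun_prop]
theorem PolyTime.snd : PolyTime fun p : α × β => p.2 := by
  refine .intro (caseTop .skip dropTop) X (30 * X + 20) (fun p => by simp; lia) fun p m => ?_
  refine (runs_caseTop_node (runs_dropTop (encode p.1) _ [])).mono ?_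
  have := size_encode_le p.1
  simp only [Polynomial.eval_add, Polynomial.eval_mul, Polynomial.eval_X, Polynomial.eval_ofNat,
    weight_prod]
  lia

@[fun_prop]
theorem PolyTime.pair {f : α → β} {g : α → γ} (hf : PolyTime f) (hg : PolyTime g) :
    PolyTime fun a => (f a, g a) := by
  obtain ⟨p, q, hq, hp⟩ := hf
  obtain ⟨p', q', hq', hp'⟩ := hg
  refine .intro (.seq dupTop (.seq p (.seq swapTop (.seq p' (.seq swapTop consTop)))))
    (q + q' + 1) (30 * X + 30 * q + 30 * q' + 30) (fun a => ?_) fun a m => ?_ <;>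
    simp only [Polynomial.eval_add, Polynomial.eval_mul, Polynomial.eval_X, Polynomial.eval_one,
      Polynomial.eval_ofNat, weight_prod]
  · exact Nat.add_le_add_right (add_le_add (hq a) (hq' a)) 1
  · refine ((runs_dupTop (encode a) m).seq ((hp a _).seq ((runs_swapTop _ _ _).seq
      ((hp' a _).seq ((runs_swapTop _ _ _).seq (runs_consTop _ _ m [])))))).mono ?_
    have := hq a
    have := hq' a
    have := size_encode_le a
    have := size_encode_le (f a)
    have := size_encode_le (g a)
    lia

/-- Removes a truth value from the top and runs `p` or `q` accordingly. -/
def ifTop (p q : Prog Reg Sym) : Prog Reg Sym := caseTop q (.seq dropTop (.seq dropTop p))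

theorem runs_ifTop {p q : Prog Reg Sym} {b : Bool} {m : List Sym} {S : Reg → List Sym} {n : ℕ}
    (h : Runs (if b then p else q) (onMain m) S n) :
    Runs (ifTop p q) (onMain ((encode b).code ++ m)) S (21 + n) := by
  cases b with
  | false => exact (runs_caseTop_nil h).mono (by lia)
  | true =>
    exact (runs_caseTop_node ((runs_dropTop .nil _ []).seq ((runs_dropTop .nil m []).seq h))).mono
      (by simp only [Data.size]; lia)

@[fun_prop]
theorem PolyTime.ite {c : α → Bool} {f g : α → β} (hc : PolyTime c) (hf : PolyTime f)
    (hg : PolyTime g) : PolyTime fun a => if c a then f a else g a := by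
  obtain ⟨p₀, q₀, _, hp₀⟩ := hc
  obtain ⟨p, q, hq, hp⟩ := hf
  obtain ⟨p', q', hq', hp'⟩ := hg
  refine .intro (.seq dupTop (.seq p₀ (ifTop p p'))) (q + q') (30 * X + q₀ + q + q' + 30)
    (fun a => ?_) fun a m => ?_ <;>
    simp only [Polynomial.eval_add, Polynomial.eval_mul, Polynomial.eval_X, Polynomial.eval_ofNat]
  · have := hq a
    have := hq' a
    split <;> lia
  · have hbranch : Runs (if c a then p else p') (onMain ((encode a).code ++ m))
        (onMain ((encode (if c a then f a else g a)).code ++ m))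
        (q.eval (weight a) + q'.eval (weight a)) := by
      split
      · exact (hp a m).mono (Nat.le_add_right _ _)
      · exact (hp' a m).mono (Nat.le_add_left _ _)
    have := size_encode_le a
    exact ((runs_dupTop (encode a) m).seq ((hp₀ a _).seq (runs_ifTop hbranch))).mono (by lia)

theorem PolyTime.decide_encode_eq {f : α → β} {g : α → γ} (hf : PolyTime f) (hg : PolyTime g) :
    PolyTime fun a => decide (encode (f a) = encode (g a)) := by
  suffices PolyTime fun p : β × γ => decide (encode p.1 = encode p.2) from this.comp (hf.pair hg)
  refine .intro (caseTop .skip eqTop) 3 (20 * X + 30)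
    (fun _ => by simpa using weight_bool_le _) fun p m => ?_
  refine (runs_caseTop_node (runs_eqTop (encode p.1) (encode p.2) m)).mono ?_
  have := size_encode_le p.1
  have := size_encode_le p.2
  simp only [Polynomial.eval_add, Polynomial.eval_mul, Polynomial.eval_X, Polynomial.eval_ofNat,
    weight_prod]
  lia

@[fun_prop]
theorem PolyTime.and {f g : α → Bool} (hf : PolyTime f) (hg : PolyTime g) :
    PolyTime fun a => f a && g a := by
  have h : PolyTime fun a => if f a then g a else false := by fun_prop
  simpa using h

@[fun_prop]
theorem PolyTime.not {f : α → Bool} (hf : PolyTime f) : PolyTime fun a => !f a := by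
  have h : PolyTime fun a => if f a then false else true := by fun_prop
  simpa using h

@[fun_prop]
theorem PolyTime.or {f g : α → Bool} (hf : PolyTime f) (hg : PolyTime g) :
    PolyTime fun a => f a || g a := by
  have h : PolyTime fun a => if f a then true else g a := by fun_prop
  simpa using h

@[fun_prop]
theorem PolyTime.cons {f : α → β} {g : α → List β} (hf : PolyTime f) (hg : PolyTime g) :
    PolyTime fun a => f a :: g a := by
  obtain ⟨q, hq⟩ := (hf.pair hg).exists_weight_le
  exact (hf.pair hg).congr_encode (fun _ => rfl) q hq

theorem PolyTime.listCases {f : α → List β} {g : α → γ} {h : α → β → List β → γ}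
    (hf : PolyTime f) (hg : PolyTime g)
    (hh : PolyTime fun p : α × β × List β => h p.1 p.2.1 p.2.2) :
    PolyTime fun a => match f a with
      | [] => g a
      | x :: l => h a x l := by
  suffices PolyTime fun p : List β × α => match p.1 with
      | [] => g p.2
      | x :: l => h p.2 x l from this.comp (hf.pair .id)
  obtain ⟨p, q, hq, hp⟩ := hg
  obtain ⟨p', q', hq', hp'⟩ : PolyTime fun r : (List β × α) × β => h r.1.2 r.2 r.1.1 :=
    hh.comp (f := fun r : (List β × α) × β => (r.1.2, r.2, r.1.1)) (by fun_prop)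
  refine .intro (caseTop .skip (caseTop p (.seq consBelow (.seq consTop p')))) (q + q')
    (30 * X + q + q' + 30) (fun ⟨l, a⟩ => ?_) fun ⟨l, a⟩ m => ?_ <;> cases l with
    | nil => ?_
    | cons x l => ?_
  all_goals
    simp only [Polynomial.eval_add, Polynomial.eval_mul, Polynomial.eval_X, Polynomial.eval_ofNat,
      weight_prod, weight_nil, weight_cons]
  · exact (hq a).trans ((eval_mono q (by lia)).trans (Nat.le_add_right _ _))
  · refine (hq' ((l, a), x)).trans ((eval_mono q' ?_).trans (Nat.le_add_left _ _))
    simp only [weight_prod]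
    lia
  · have ha := (hp a m).mono (eval_mono q (b := 1 + weight a + 1) (by lia))
    exact (runs_caseTop_node (runs_caseTop_nil ha)).mono (by lia)
  · have hnode := (hp' ((l, a), x) m).mono
      (eval_mono q' (b := weight x + weight l + 1 + weight a + 1) (by simp only [weight_prod]; lia))
    refine (runs_caseTop_node (runs_caseTop_node ((runs_consBelow _ _ _ _).seq
      ((runs_consTop _ _ m []).seq hnode)))).mono ?_
    have := size_encode_le x
    have := size_encode_le l
    have := size_encode_le a
    lia

@[fun_prop]
theorem PolyTime.isEmpty {f : α → List β} (hf : PolyTime f) : PolyTime fun a => (f a).isEmpty := by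
  have h : PolyTime fun a => match f a with
      | [] => true
      | _ :: _ => false := .listCases hf (by fun_prop) (by fun_prop)
  convert h using 2 with a
  cases f a <;> rfl

/-! ### Iteration over lists -/

/-- The body of a loop that folds a list: the top is the head of the remaining list, and the
remaining tail and the current state are below. -/
def foldBody (p : Prog Reg Sym) : Prog Reg Sym :=
  .seq swapTop (.seq consBelow (.seq p swapTop))

theorem runs_foldLoop {p : Prog Reg Sym} {q : Polynomial ℕ} {step : γ → β → γ}
    (hp : ∀ x s m, Runs p (onMain ((encode (x, s)).code ++ m))
      (onMain ((encode (step s x)).code ++ m)) (q.eval (weight (x, s))))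
    {n : ℕ} {l : List β} {s : γ} (hl : weight l ≤ n)
    (hs : ∀ l', l' <+: l → weight (l'.foldl step s) ≤ n) (m : List Sym) :
    Runs (whileLoop (foldBody p)) (regs ((encode l).code ++ ((encode s).code ++ m)) [] [] [one])
      (onMain ((encode (l.foldl step s)).code ++ m))
      (l.length * (q.eval (2 * n + 1) + 60 * n + 50) + 4) := by
  induction l generalizing s with
  | nil => exact (runs_whileLoop_nil _ _ []).mono (by lia)
  | cons x l ih =>
    simp only [weight_cons] at hl
    have htail := ih (s := step s x) (by lia)
      fun l' hl' => hs (x :: l') (by simpa using hl')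
    have hweight : weight s ≤ n := hs [] List.nil_prefix
    have hweight' : weight (step s x) ≤ n := hs [x] (by simp)
    have hstep := (hp x s ((encode l).code ++ m)).mono
      (eval_mono q (b := 2 * n + 1) (by simp only [weight_prod]; lia))
    have hbody := (runs_swapTop (encode x) (encode l) ((encode s).code ++ m)).seq
      ((runs_consBelow (encode l) (encode x) (encode s) m).seq
        (hstep.seq (runs_swapTop (encode (step s x)) (encode l) m)))
    refine (runs_whileLoop_node hbody htail).mono ?_
    have := size_encode_le x
    have := size_encode_le l
    have := size_encode_le s
    have := size_encode_le (step s x)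
    simp only [List.length_cons, add_mul, one_mul]
    lia

theorem PolyTime.foldl_of_closed {f : α → List β} {init : α → γ} {step : γ → β → γ}
    (hf : PolyTime f) (hi : PolyTime init) (hs : PolyTime fun p : β × γ => step p.2 p.1)
    (q : Polynomial ℕ)
    (hq : ∀ a l, l <+: f a → weight (l.foldl step (init a)) ≤ q.eval (weight a)) :
    PolyTime fun a => (f a).foldl step (init a) := by
  obtain ⟨p₁, q₁, hq₁, hp₁⟩ := hf.pair hi
  obtain ⟨p₂, q₂, _, hp₂⟩ := hs
  let n : Polynomial ℕ := q₁ + q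
  refine .intro (.seq p₁ (caseTop .skip (whileTop (foldBody p₂)))) q
    (q₁ + n * (q₂.comp (2 * n + 1) + 60 * n + 50) + 20) (fun a => hq a _ List.prefix_rfl)
    fun a m => ?_
  have hweight := hq₁ a
  have hlength := length_lt_weight (f a)
  have hn : n.eval (weight a) = q₁.eval (weight a) + q.eval (weight a) := Polynomial.eval_add
  simp only [weight_prod] at hweight
  have hloop := runs_foldLoop (n := n.eval (weight a)) (fun x s => hp₂ (x, s))
    (show weight (f a) ≤ _ by lia) (fun l hl => (hq a l hl).trans (by lia)) m
  refine ((hp₁ a m).seq (runs_caseTop_node (runs_whileTop hloop))).mono ?_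
  have hmul := Nat.mul_le_mul_right
    (q₂.eval (2 * n.eval (weight a) + 1) + 60 * n.eval (weight a) + 50)
    (show (f a).length ≤ n.eval (weight a) by lia)
  simp only [Polynomial.eval_add, Polynomial.eval_mul, Polynomial.eval_comp, Polynomial.eval_one,
    Polynomial.eval_ofNat]
  lia

theorem foldl_mk_const {α β γ : Type*} (step : α → γ → β → γ) (l : List β) (s : γ) (a : α) :
    l.foldl (fun (s : γ × α) x => (step s.2 s.1 x, s.2)) (s, a) = (l.foldl (step a) s, a) := by
  induction l generalizing s with
  | nil => rfl
  | cons x _ ih => exact ih _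

theorem PolyTime.foldl_of_bound {f : α → List β} {init : α → γ} {step : α → γ → β → γ}
    (hf : PolyTime f) (hi : PolyTime init)
    (hs : PolyTime fun p : α × γ × β => step p.1 p.2.1 p.2.2) (q : Polynomial ℕ)
    (hq : ∀ a l, l <+: f a → weight (l.foldl (step a) (init a)) ≤ q.eval (weight a)) :
    PolyTime fun a => (f a).foldl (step a) (init a) := by
  have hstep : PolyTime fun p : β × γ × α => step p.2.2 p.2.1 p.1 :=
    hs.comp (f := fun p : β × γ × α => (p.2.2, p.2.1, p.1)) (by fun_prop)
  have h : PolyTime fun a =>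
      (f a).foldl (fun (s : γ × α) x => (step s.2 s.1 x, s.2)) (init a, a) :=
    .foldl_of_closed hf (by fun_prop) (hstep.pair (by fun_prop)) (q + X + 1) fun a l hl => by
      simpa [foldl_mk_const, add_assoc] using hq a l hl
  simpa only [foldl_mk_const] using PolyTime.fst.comp h

theorem PolyTime.foldl {f : α → List β} {init : α → γ} {step : α → γ → β → γ}
    (hf : PolyTime f) (hi : PolyTime init)
    (hs : PolyTime fun p : α × γ × β => step p.1 p.2.1 p.2.2) (q : Polynomial ℕ)
    (hq : ∀ a s x, weight (step a s x) ≤ weight s + q.eval (weight a + weight x)) :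
    PolyTime fun a => (f a).foldl (step a) (init a) := by
  obtain ⟨q₁, hq₁⟩ := hf.exists_weight_le
  obtain ⟨q₂, hq₂⟩ := hi.exists_weight_le
  refine .foldl_of_bound hf hi hs (q₂ + q₁ * q.comp (X + q₁)) fun a l hl => ?_
  have hfold := weight_foldl_le (step := step a) (l := l)
    (n := q.eval (weight a + q₁.eval (weight a)))
    (fun s x hx => (hq a s x).trans <| Nat.add_le_add_left (eval_mono q <|
      Nat.add_le_add_left ((weight_le_of_mem (hl.subset hx)).trans (hq₁ a)) _) _) (init a)
  have hlength : l.length ≤ q₁.eval (weight a) :=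
    hl.length_le.trans ((length_lt_weight _).le.trans (hq₁ a))
  simp only [Polynomial.eval_add, Polynomial.eval_mul, Polynomial.eval_comp, Polynomial.eval_X]
  exact hfold.trans (add_le_add (hq₂ a) (Nat.mul_le_mul_right _ hlength))

@[fun_prop]
theorem PolyTime.reverse {f : α → List β} (hf : PolyTime f) : PolyTime fun a => (f a).reverse := by
  have h : PolyTime fun a => (f a).foldl (fun l x => x :: l) [] :=
    .foldl hf (by fun_prop) (by fun_prop) (X + 1) fun a s x => by simp; lia
  simpa using h

theorem PolyTime.foldr_of_bound {f : α → List β} {init : α → γ} {step : α → β → γ → γ}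
    (hf : PolyTime f) (hi : PolyTime init)
    (hs : PolyTime fun p : α × β × γ => step p.1 p.2.1 p.2.2) (q : Polynomial ℕ)
    (hq : ∀ a l, l <:+ f a → weight (l.foldr (step a) (init a)) ≤ q.eval (weight a)) :
    PolyTime fun a => (f a).foldr (step a) (init a) := by
  have h : PolyTime fun a => (f a).reverse.foldl (fun s x => step a x s) (init a) :=
    .foldl_of_bound hf.reverse hi
      (hs.comp (f := fun p : α × γ × β => (p.1, p.2.2, p.2.1)) (by fun_prop)) q fun a l hl => by
        rw [List.foldl_eq_foldr_reverse]
        exact hq a _ (by rwa [← List.reverse_prefix, List.reverse_reverse])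
  simpa only [List.foldl_reverse] using h

theorem PolyTime.foldr {f : α → List β} {init : α → γ} {step : α → β → γ → γ}
    (hf : PolyTime f) (hi : PolyTime init)
    (hs : PolyTime fun p : α × β × γ => step p.1 p.2.1 p.2.2) (q : Polynomial ℕ)
    (hq : ∀ a x s, weight (step a x s) ≤ weight s + q.eval (weight a + weight x)) :
    PolyTime fun a => (f a).foldr (step a) (init a) := by
  have h : PolyTime fun a => (f a).reverse.foldl (fun s x => step a x s) (init a) :=
    .foldl hf.reverse hi
      (hs.comp (f := fun p : α × γ × β => (p.1, p.2.2, p.2.1)) (by fun_prop)) q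
      fun a s x => hq a x s
  simpa only [List.foldl_reverse] using h

@[fun_prop]
theorem PolyTime.append {f g : α → List β} (hf : PolyTime f) (hg : PolyTime g) :
    PolyTime fun a => f a ++ g a := by
  have h : PolyTime fun a => (f a).foldr (fun x l => x :: l) (g a) :=
    .foldr hf hg (by fun_prop) (X + 1) fun a x s => by simp; lia
  simpa using h

theorem PolyTime.flatMap {f : α → List β} {g : α → β → List γ} (hf : PolyTime f)
    (hg : PolyTime fun p : α × β => g p.1 p.2) : PolyTime fun a => (f a).flatMap (g a) := by
  obtain ⟨q, hq⟩ := hg.exists_weight_le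
  have hstep : PolyTime fun p : α × β × List γ => g p.1 p.2.1 :=
    hg.comp (f := fun p : α × β × List γ => (p.1, p.2.1)) (by fun_prop)
  have h : PolyTime fun a => (f a).foldr (fun x l => g a x ++ l) [] :=
    .foldr hf (by fun_prop) (hstep.append (by fun_prop)) (q.comp (X + 1)) fun a x l => by
      have := hq (a, x)
      have := weight_append (g a x) l
      simp only [weight_prod, Polynomial.eval_comp, Polynomial.eval_add, Polynomial.eval_X,
        Polynomial.eval_one] at *
      lia
  convert h using 2 with a
  induction f a with
  | nil => rfl
  | cons x l ih => rw [List.flatMap_cons, ih, List.foldr_cons]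

theorem PolyTime.map {f : α → List β} {g : α → β → γ} (hf : PolyTime f)
    (hg : PolyTime fun p : α × β => g p.1 p.2) : PolyTime fun a => (f a).map (g a) := by
  have h : PolyTime fun a => (f a).flatMap fun x => [g a x] :=
    .flatMap hf (hg.cons (by fun_prop))
  simpa only [List.map_eq_flatMap] using h

theorem PolyTime.filter {f : α → List β} {g : α → β → Bool} (hf : PolyTime f)
    (hg : PolyTime fun p : α × β => g p.1 p.2) : PolyTime fun a => (f a).filter (g a) := by
  have h : PolyTime fun a => (f a).flatMap fun x => if g a x then [x] else [] :=
    .flatMap hf (hg.ite (by fun_prop) (by fun_prop))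
  convert h using 2 with a
  induction f a with
  | nil => rfl
  | cons x l ih => by_cases hx : g a x <;> simp [ih, hx]

theorem PolyTime.any {f : α → List β} {g : α → β → Bool} (hf : PolyTime f)
    (hg : PolyTime fun p : α × β => g p.1 p.2) : PolyTime fun a => (f a).any (g a) := by
  have h : PolyTime fun a => !((f a).filter (g a)).isEmpty := (hf.filter hg).isEmpty.not
  convert h using 2 with a
  rw [Bool.eq_iff_iff]
  simp

theorem PolyTime.all {f : α → List β} {g : α → β → Bool} (hf : PolyTime f)
    (hg : PolyTime fun p : α × β => g p.1 p.2) : PolyTime fun a => (f a).all (g a) := by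
  have h : PolyTime fun a => !(f a).any fun x => !g a x := (hf.any hg.not).not
  simpa only [← List.all_eq_not_any_not] using h

/-- The step of a computation of `List.zip`: moves the first element of the remaining second list
to the result, paired with `x`. -/
def zipStep {β γ : Type} (s : List γ × List (β × γ)) (x : β) : List γ × List (β × γ) :=
  match s.1 with
  | [] => ([], s.2)
  | y :: l => (l, (x, y) :: s.2)

theorem foldl_zipStep {β γ : Type} (l : List β) (s : List γ × List (β × γ)) :
    (l.foldl zipStep s).2 = (l.zip s.1).reverse ++ s.2 := by
  induction l generalizing s with
  | nil => simp
  | cons x l ih => obtain ⟨_ | ⟨y, l'⟩, r⟩ := s <;> simp [ih, zipStep]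

@[fun_prop]
theorem PolyTime.zip {f : α → List β} {g : α → List γ} (hf : PolyTime f) (hg : PolyTime g) :
    PolyTime fun a => (f a).zip (g a) := by
  have hstep : PolyTime fun p : α × (List γ × List (β × γ)) × β => zipStep p.2.1 p.2.2 :=
    .listCases (f := fun p : α × (List γ × List (β × γ)) × β => p.2.1.1) (by fun_prop)
      (by fun_prop) (by fun_prop)
  have h : PolyTime fun a => ((f a).foldl zipStep (g a, [])).2.reverse := by
    refine .reverse (.comp .snd (.foldl hf (by fun_prop) hstep (X + 2) ?_))
    rintro a ⟨_ | ⟨y, l⟩, r⟩ x <;> simp only [zipStep, weight_prod, weight_nil, weight_cons,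
      Polynomial.eval_add, Polynomial.eval_X, Polynomial.eval_ofNat] <;> lia
  simpa [foldl_zipStep] using h

end StackProgram

namespace ConjQuery

/-! ### Systems of equations -/

/-- Partial assignments, as lists of equations `t = v` between a term and a data value. -/
abbrev Equations := List (Term × ℕ)

/-- `θ` is a solution of all equations in the list. -/
def Solves (θ : ℕ → ℕ) (σ : Equations) : Prop := ∀ p ∈ σ, p.1.subst θ = p.2

/-- Whether the term is a variable. -/
def Term.isVar : Term → Bool
  | .var _ => true
  | .const _ => false

/-- The variable or the constant that the term consists of. -/
def Term.name : Term → ℕ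
  | .var x => x
  | .const c => c

/-- Decides whether a system of equations has a solution. -/
def consistent (σ : Equations) : Bool :=
  σ.all fun p => (p.1.isVar || decide (p.1.name = p.2)) &&
    σ.all fun q => !decide (p.1 = q.1) || decide (p.2 = q.2)

variable {θ : ℕ → ℕ} {σ τ : Equations}

theorem consistent_iff_forall : consistent σ ↔
    ∀ p ∈ σ, (p.1.isVar ∨ p.1.name = p.2) ∧ ∀ q ∈ σ, p.1 = q.1 → p.2 = q.2 := by
  simp only [consistent, List.all_eq_true, Bool.and_eq_true, Bool.or_eq_true, Bool.not_eq_true',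
    decide_eq_false_iff_not, decide_eq_true_eq, imp_iff_not_or]

theorem Solves.consistent (h : Solves θ σ) : consistent σ := by
  refine consistent_iff_forall.2 fun p hp => ⟨?_, fun q hq hpq => ?_⟩
  · have := h p hp
    rcases p with ⟨⟨x⟩ | ⟨c⟩, v⟩
    exacts [.inl rfl, .inr this]
  · rw [← h p hp, ← h q hq, hpq]

theorem exists_solves_of_consistent (h : consistent σ) : ∃ θ, Solves θ σ := by
  classical
  rw [consistent_iff_forall] at h
  refine ⟨fun x => if h : ∃ v, (Term.var x, v) ∈ σ then h.choose else 0, ?_⟩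
  rintro ⟨⟨x⟩ | ⟨c⟩, v⟩ hp
  · have hx : ∃ v, (Term.var x, v) ∈ σ := ⟨v, hp⟩
    simpa only [Term.subst, dif_pos hx] using (h _ hx.choose_spec).2 _ hp rfl
  · exact (h _ hp).1.resolve_left Bool.false_ne_true

theorem consistent_iff_exists_solves : consistent σ ↔ ∃ θ, Solves θ σ :=
  ⟨exists_solves_of_consistent, fun ⟨_, h⟩ => h.consistent⟩

theorem solves_append : Solves θ (σ ++ τ) ↔ Solves θ σ ∧ Solves θ τ :=
  List.forall_mem_append

theorem value_unique (h : consistent σ) {t : Term} {v w : ℕ} (hv : (t, v) ∈ σ)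
    (hw : (t, w) ∈ σ) : v = w :=
  (consistent_iff_forall.1 h _ hv).2 _ hw rfl

theorem consistent_append_comm : consistent (σ ++ τ) ↔ consistent (τ ++ σ) := by
  simp only [consistent_iff_exists_solves, solves_append, and_comm]

theorem consistent_append (hσ : consistent σ) (hτ : consistent τ)
    (h : ∀ p ∈ σ, ∀ q ∈ τ, p.1 = q.1 → p.2 = q.2) : consistent (σ ++ τ) := by
  simp only [consistent_iff_forall, List.forall_mem_append] at hσ hτ ⊢
  exact ⟨fun p hp => ⟨(hσ p hp).1, (hσ p hp).2, h p hp⟩,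
    fun q hq => ⟨(hτ q hq).1, fun p hp e => (h p hp q hq e.symm).symm, (hτ q hq).2⟩⟩

theorem consistent_flatten {L : List Equations} (h : ∀ σ ∈ L, ∀ τ ∈ L, consistent (σ ++ τ)) :
    consistent L.flatten := by
  simp only [consistent_iff_forall, List.mem_flatten, List.mem_append] at h ⊢
  rintro p ⟨σ, hσ, hp⟩
  refine ⟨(h σ hσ σ hσ p (.inl hp)).1, ?_⟩
  rintro q ⟨τ, hτ, hq⟩
  exact (h σ hσ τ hτ p (.inl hp)).2 q (.inr hq)

/-! ### Matching atoms with facts -/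

theorem solves_zip_iff {ts : List Term} {vs : List ℕ} (h : ts.length = vs.length) :
    Solves θ (ts.zip vs) ↔ ts.map (Term.subst θ) = vs := by
  induction ts generalizing vs with
  | nil => cases vs <;> simp_all [Solves]
  | cons t ts ih =>
    cases vs with
    | nil => simp at h
    | cons v vs => simp [← ih (by simpa using h), Solves]

theorem solves_zip_args_iff {A : Atom} {f : Fact} (hr : A.rel = f.rel)
    (hl : A.args.length = f.args.length) : Solves θ (A.args.zip f.args) ↔ A.subst θ = f := by
  rw [solves_zip_iff hl]
  cases f
  simp_all [Atom.subst]

theorem solves_zip_subst (A : Atom) : Solves θ (A.args.zip (A.subst θ).args) :=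
  (solves_zip_args_iff (by rfl) (by simp [Atom.subst])).2 rfl

theorem Atom.subst_congr {A : Atom} {θ' : ℕ → ℕ} (h : ∀ x ∈ A.vars, θ x = θ' x) :
    A.subst θ = A.subst θ' := by
  simp only [Atom.subst, Fact.mk.injEq, true_and]
  refine List.map_congr_left ?_
  rintro (x | c) hx
  exacts [h x hx, rfl]

/-- Every atom of the list is an instance under `θ` of one of the facts. -/
def IsMatch (θ : ℕ → ℕ) (As : List Atom) (facts : List Fact) : Prop :=
  ∀ A ∈ As, A.subst θ ∈ facts

/-- All ways to match the first `k` atoms of a list with facts. -/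
def matchings (facts : List Fact) : ℕ → List Atom → List Equations
  | 0, _ => [[]]
  | _ + 1, [] => [[]]
  | k + 1, A :: As => facts.flatMap fun f =>
      if decide (A.rel = f.rel) then (matchings facts k As).map fun τ => A.args.zip f.args ++ τ
      else []

variable {facts : List Fact} {k : ℕ}

theorem mem_matchings_cons {A : Atom} {As : List Atom} :
    τ ∈ matchings facts (k + 1) (A :: As) ↔ ∃ f ∈ facts, A.rel = f.rel ∧
      ∃ τ' ∈ matchings facts k As, A.args.zip f.args ++ τ' = τ := by
  simp only [matchings, List.mem_flatMap, decide_eq_true_eq, List.mem_ite_nil_right, List.mem_map]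

theorem exists_zip_subset_of_mem_matchings {As : List Atom} (hk : As.length ≤ k)
    (hτ : τ ∈ matchings facts k As) {A : Atom} (hA : A ∈ As) :
    ∃ f ∈ facts, A.rel = f.rel ∧ A.args.zip f.args ⊆ τ := by
  induction As generalizing k τ with
  | nil => simp at hA
  | cons B As ih =>
    obtain ⟨k, rfl⟩ : ∃ k', k = k' + 1 := Nat.exists_eq_add_one.2 (Nat.zero_lt_of_lt hk)
    obtain ⟨f, hf, hr, τ, hτ', rfl⟩ := mem_matchings_cons.1 hτ
    rcases List.mem_cons.1 hA with rfl | hA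
    · exact ⟨f, hf, hr, List.subset_append_left _ _⟩
    · obtain ⟨g, hg, hr, hs⟩ := ih (by simpa using hk) hτ' hA
      exact ⟨g, hg, hr, List.subset_append_of_subset_right _ hs⟩

theorem IsMatch.exists_mem_matchings (k : ℕ) {As : List Atom} (h : IsMatch θ As facts) :
    ∃ τ ∈ matchings facts k As, Solves θ τ := by
  induction As generalizing k with
  | nil => exact ⟨[], by cases k <;> simp [matchings], by simp [Solves]⟩
  | cons A As ih =>
    cases k with
    | zero => exact ⟨[], by simp [matchings], by simp [Solves]⟩
    | succ k =>
      obtain ⟨τ, hτ, hs⟩ := ih k fun B hB => h B (List.mem_cons_of_mem _ hB)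
      exact ⟨_, mem_matchings_cons.2 ⟨_, h A List.mem_cons_self, rfl, τ, hτ, rfl⟩,
        solves_append.2 ⟨solves_zip_subst A, hs⟩⟩

/-- The equations of `τ` for the variables in the list `xs`. -/
def restrict (xs : List ℕ) (τ : Equations) : Equations :=
  τ.filter fun p => xs.any fun x => decide (p.1 = .var x)

theorem mem_restrict {xs : List ℕ} {p : Term × ℕ} :
    p ∈ restrict xs τ ↔ p ∈ τ ∧ ∃ x ∈ xs, p.1 = .var x := by
  simp [restrict]

theorem Solves.restrict (h : Solves θ τ) (xs : List ℕ) : Solves θ (restrict xs τ) :=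
  fun p hp => h p (mem_restrict.1 hp).1

/-- Decides whether some instance of the atom that extends `τ` is, up to the arity, a fact. -/
def matchable (facts : List Fact) (τ : Equations) (A : Atom) : Bool :=
  facts.any fun f => decide (A.rel = f.rel) && consistent (A.args.zip f.args ++ τ)

theorem matchable_iff {A : Atom} : matchable facts τ A ↔
    ∃ f ∈ facts, A.rel = f.rel ∧ consistent (A.args.zip f.args ++ τ) := by
  simp [matchable]

/-- The relation at a vertex with labels `v = (χ, λ)`: the matchings of the atoms in `λ` with facts,
restricted to `χ`, that are compatible with `σ` and with every single atom of the body. -/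
def vertexRel (k : ℕ) (facts : List Fact) (body : List Atom) (σ : Equations)
    (v : List ℕ × List Atom) : List Equations :=
  ((matchings facts k v.2.dedup).map (restrict v.1)).filter fun τ =>
    consistent (τ ++ σ) && body.all (matchable facts τ)

variable {body : List Atom} {v : List ℕ × List Atom}

theorem mem_vertexRel : τ ∈ vertexRel k facts body σ v ↔
    (∃ τ₀ ∈ matchings facts k v.2.dedup, restrict v.1 τ₀ = τ) ∧ consistent (τ ++ σ) ∧
      ∀ A ∈ body, matchable facts τ A := by
  simp only [vertexRel, List.mem_filter, List.mem_map, Bool.and_eq_true, List.all_eq_true]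

theorem exists_eq_var_of_mem_vertexRel (hτ : τ ∈ vertexRel k facts body σ v) {p : Term × ℕ}
    (hp : p ∈ τ) : ∃ x ∈ v.1, p.1 = .var x := by
  obtain ⟨⟨τ₀, -, rfl⟩, -⟩ := mem_vertexRel.1 hτ
  exact (mem_restrict.1 hp).2

theorem exists_value_of_mem_vertexRel (hk : v.2.dedup.length ≤ k)
    (hτ : τ ∈ vertexRel k facts body σ v) {A : Atom} (hA : A ∈ v.2)
    (hlen : ∀ f ∈ facts, A.rel = f.rel → A.args.length = f.args.length) {x : ℕ} (hx : x ∈ v.1)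
    (hxA : x ∈ A.vars) : ∃ a, (Term.var x, a) ∈ τ := by
  obtain ⟨⟨τ₀, hτ₀, rfl⟩, -⟩ := mem_vertexRel.1 hτ
  obtain ⟨f, hf, hr, hs⟩ := exists_zip_subset_of_mem_matchings hk hτ₀ (List.mem_dedup.2 hA)
  obtain ⟨i, hi, hix⟩ := List.getElem_of_mem hxA
  have hif : i < f.args.length := hlen f hf hr ▸ hi
  refine ⟨f.args[i], mem_restrict.2 ⟨hs ?_, x, hx, rfl⟩⟩
  rw [← hix, ← List.getElem_zip (h := by simp [hi, hif])]
  exact List.getElem_mem _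

theorem IsMatch.exists_mem_vertexRel (hθ : IsMatch θ body facts) (hσ : Solves θ σ)
    (hv : v.2 ⊆ body) : ∃ τ ∈ vertexRel k facts body σ v, Solves θ τ := by
  obtain ⟨τ, hτ, hs⟩ := IsMatch.exists_mem_matchings (θ := θ) (facts := facts) k
    (As := v.2.dedup) fun A hA => hθ A (hv (List.mem_dedup.1 hA))
  have hs' := hs.restrict v.1
  exact ⟨_, mem_vertexRel.2 ⟨⟨τ, hτ, rfl⟩, (solves_append.2 ⟨hs', hσ⟩).consistent, fun A hA =>
    matchable_iff.2 ⟨_, hθ A hA, rfl, (solves_append.2 ⟨solves_zip_subst A, hs'⟩).consistent⟩⟩, hs'⟩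

/-! ### Semijoins along the tree -/

section Semijoins

variable {V T : Type} (rel : V → List T) (ok : T → T → Bool)

/-- Going through the relations `rel v` from the last to the first, keeps the elements that match
some remaining element of each later relation. -/
def semijoins (l : List V) : List (List T) :=
  l.foldr (fun v Rs => ((rel v).filter fun t => Rs.all fun R => R.any fun t' => ok t t') :: Rs) []

@[simp] theorem semijoins_cons (v : V) (l : List V) : semijoins rel ok (v :: l) =
    ((rel v).filter fun t => (semijoins rel ok l).all fun R => R.any fun t' => ok t t') ::
      semijoins rel ok l := rfl

@[simp] theorem length_semijoins (l : List V) : (semijoins rel ok l).length = l.length := by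
  induction l with
  | nil => rfl
  | cons v l ih => simpa using ih

theorem pairwise_semijoins (l : List V) :
    (semijoins rel ok l).Pairwise fun R R' => ∀ t ∈ R, ∃ t' ∈ R', ok t t' := by
  induction l with
  | nil => exact .nil
  | cons v l ih =>
    refine .cons (fun R hR t ht => ?_) ih
    simp only [List.mem_filter, List.all_eq_true, List.any_eq_true] at ht
    exact ht.2 R hR

theorem getElem_semijoins_subset (l : List V) (i : ℕ) (hi : i < l.length) :
    (semijoins rel ok l)[i]'(by simpa) ⊆ rel l[i] := by
  induction l generalizing i with
  | nil => simp at hi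
  | cons v l ih =>
    cases i with
    | zero => exact List.filter_subset_self _
    | succ i => exact ih i (by simpa using hi)

variable {rel ok}

theorem exists_mem_of_mem_semijoins {P : T → Prop} (hP : ∀ t t', P t → P t' → ok t t')
    {l : List V} (h : ∀ v ∈ l, ∃ t ∈ rel v, P t) : ∀ R ∈ semijoins rel ok l, ∃ t ∈ R, P t := by
  induction l with
  | nil => simp [semijoins]
  | cons v l ih =>
    rw [List.forall_mem_cons] at h
    have ih := ih h.2
    obtain ⟨t, ht, hPt⟩ := h.1
    rw [semijoins_cons, List.forall_mem_cons]
    refine ⟨⟨t, ?_, hPt⟩, ih⟩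
    simp only [List.mem_filter, List.all_eq_true, List.any_eq_true]
    exact ⟨ht, fun R hR => (ih R hR).imp fun t' ht' => ⟨ht'.1, hP t t' hPt ht'.2⟩⟩

end Semijoins

namespace Hypertree

variable {H : Hypertree} {Q : Query}

theorem exists_choice {T : Type} {R : H.Vertex → Set T} {ok : T → T → Prop}
    (hR : ∀ p, (R p).Nonempty) (hok : ∀ p q, p < q → ∀ t ∈ R p, ∃ t' ∈ R q, ok t t') :
    ∃ τ : H.Vertex → T, ∀ p, τ p ∈ R p ∧ (p ≠ 0 → ok (τ (H.parent p)) (τ p)) := by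
  choose next hnext using hok
  let choose_step (p : H.Vertex) (ih : ∀ q < p, R q) : R p :=
    if h : p = 0 then ⟨_, (hR p).some_mem⟩
    else ⟨_, (hnext _ p (H.parent_lt p h) _ (ih _ (H.parent_lt p h)).2).1⟩
  refine ⟨fun p => (wellFounded_lt.fix choose_step p : R p), fun p => ⟨Subtype.coe_prop _, ?_⟩⟩
  intro h
  beta_reduce
  rw [wellFounded_lt.fix_eq choose_step p]
  simpa only [choose_step, dif_neg h] using (hnext _ p (H.parent_lt p h) _ _).2

/-- The labels `(χ(p), λ(p))` of all vertices. -/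
def labels (H : Hypertree) : List (List ℕ × List Atom) :=
  List.ofFn fun p : Fin (H.n + 1) => (H.chiList p, H.lamList p)

theorem exists_choice_semijoins {T : Type} {rel : List ℕ × List Atom → List T}
    {ok : T → T → Bool} (h : ∀ R ∈ semijoins rel ok H.labels, R ≠ []) :
    ∃ τ : H.Vertex → T, ∀ p, τ p ∈ rel (H.chiList p, H.lamList p) ∧
      (p ≠ 0 → ok (τ (H.parent p)) (τ p)) := by
  have hlt (p : H.Vertex) : p.val < H.labels.length := by simp [labels, p.isLt]
  have hlt' (p : H.Vertex) : p.val < (semijoins rel ok H.labels).length := by simpa using hlt p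
  obtain ⟨τ, hτ⟩ := exists_choice (R := fun p => {t | t ∈ (semijoins rel ok H.labels)[p]'(hlt' p)})
    (fun p => List.exists_mem_of_ne_nil _ (h _ (List.getElem_mem (hlt' p))))
    (fun p q hpq => List.pairwise_iff_getElem.1 (pairwise_semijoins _ _ _) _ _ (hlt' p) (hlt' q)
      hpq)
  refine ⟨τ, fun p => ⟨?_, (hτ p).2⟩⟩
  simpa only [labels, List.getElem_ofFn] using
    getElem_semijoins_subset rel ok H.labels p (hlt p) (hτ p).1

/-- `H` is a generalized hypertree decomposition of `Q`: the conditions on a hypertree decomposition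
without the special condition on the subtrees `T_p`. -/
structure IsGeneralizedDecomposition (H : Hypertree) (Q : Query) : Prop where
  isHypertree : H.IsHypertreeFor Q
  covers : ∀ A ∈ Q.atoms, ∃ p, A.vars ⊆ H.chi p
  connected : ∀ x ∈ Q.vars, (H.graph.induce {p | x ∈ H.chi p}).Preconnected
  chi_subset : ∀ p, (H.chi p : Set ℕ) ⊆ H.lamVars p

theorem IsDecomposition.isGeneralizedDecomposition (h : H.IsDecomposition Q) :
    H.IsGeneralizedDecomposition Q :=
  ⟨h.isHypertree, h.covers, h.connected, h.chi_subset⟩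

theorem eq_parent_of_adj {p q : H.Vertex} (h : H.graph.Adj p q) :
    q ≠ 0 ∧ p = H.parent q ∨ p ≠ 0 ∧ q = H.parent p := by
  obtain ⟨hne, rfl | rfl⟩ := (SimpleGraph.fromRel_adj _ p q).1 h
  · exact .inr ⟨fun h => hne (by rw [h, H.parent_root]), rfl⟩
  · exact .inl ⟨fun h => hne (by rw [h, H.parent_root]), rfl⟩

theorem IsGeneralizedDecomposition.forall_of_adj (hH : H.IsGeneralizedDecomposition Q) {x : ℕ}
    {P : H.Vertex → Prop} (hP : ∀ p q, x ∈ H.chi q → H.graph.Adj p q → P p → P q) {p : H.Vertex}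
    (hp : x ∈ H.chi p) (h : P p) {q : H.Vertex} (hq : x ∈ H.chi q) : P q := by
  have hreach := hH.connected x ((hH.isHypertree p).1 x hp) ⟨p, hp⟩ ⟨q, hq⟩
  rw [SimpleGraph.reachable_iff_reflTransGen] at hreach
  suffices ∀ r, Relation.ReflTransGen (H.graph.induce {p | x ∈ H.chi p}).Adj ⟨p, hp⟩ r → P r from
    this _ hreach
  intro r hr
  induction hr with
  | refl => exact h
  | @tail q r _ hadj ih => exact hP _ _ r.prop hadj ih

/-- Along the edges inside the connected set of the vertices that contain a variable, its value
does not change. -/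
theorem IsGeneralizedDecomposition.consistent_append (hH : H.IsGeneralizedDecomposition Q)
    {τ : H.Vertex → Equations} (hvar : ∀ p, ∀ e ∈ τ p, ∃ x ∈ H.chi p, e.1 = .var x)
    (hval : ∀ p, ∀ x ∈ H.chi p, ∃ a, (Term.var x, a) ∈ τ p) (hself : ∀ p, consistent (τ p))
    (hedge : ∀ p ≠ 0, consistent (τ (H.parent p) ++ τ p)) (p q : H.Vertex) :
    consistent (τ p ++ τ q) := by
  have hadj {p q} (h : H.graph.Adj p q) : consistent (τ p ++ τ q) := by
    obtain ⟨h0, rfl⟩ | ⟨h0, rfl⟩ := eq_parent_of_adj h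
    exacts [hedge q h0, consistent_append_comm.1 (hedge p h0)]
  refine ConjQuery.consistent_append (hself p) (hself q) ?_
  rintro ⟨t, a⟩ hp ⟨_, b⟩ hq rfl
  obtain ⟨x, hx, rfl⟩ := hvar p _ hp
  obtain ⟨y, hy, ⟨⟩⟩ := hvar q _ hq
  have hpq : (Term.var x, a) ∈ τ q := by
    refine hH.forall_of_adj (P := fun r => (Term.var x, a) ∈ τ r) (fun r s hs hrs hr => ?_) hx hp hy
    obtain ⟨c, hc⟩ := hval s x hs
    rwa [value_unique (hadj hrs) (List.mem_append_left _ hr) (List.mem_append_right _ hc)]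
  exact value_unique (hself q) hpq hq

theorem dedup_lamList_length_le {k : ℕ} (hk : H.width ≤ k) (p : H.Vertex) :
    (H.lamList p).dedup.length ≤ k := by
  rw [← List.card_toFinset]
  exact (Finset.le_sup (f := fun p => (H.lam p).card) (Finset.mem_univ p)).trans hk

end Hypertree

/-! ### Deciding extendability of partial assignments -/

/-- Decides whether some solution of `σ` sends all atoms of the body to facts, by semijoins of the
vertex relations for the list `vs` of vertex labels. -/
def satisfiable (k : ℕ) (facts : List Fact) (body : List Atom) (vs : List (List ℕ × List Atom))
    (σ : Equations) : Bool :=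
  consistent σ &&
    (semijoins (vertexRel k facts body σ) (fun τ τ' => consistent (τ ++ τ')) vs).all
      fun R => !R.isEmpty

theorem satisfiable_iff {vs : List (List ℕ × List Atom)} : satisfiable k facts body vs σ ↔
    consistent σ ∧ ∀ R ∈ semijoins (vertexRel k facts body σ)
      (fun τ τ' => consistent (τ ++ τ')) vs, R ≠ [] := by
  simp [satisfiable]

theorem IsMatch.satisfiable (hθ : IsMatch θ body facts) (hσ : Solves θ σ)
    {vs : List (List ℕ × List Atom)} (hvs : ∀ v ∈ vs, v.2 ⊆ body) :
    satisfiable k facts body vs σ := by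
  refine satisfiable_iff.2 ⟨hσ.consistent, fun R hR => ?_⟩
  obtain ⟨τ, hτ, -⟩ := exists_mem_of_mem_semijoins (P := Solves θ)
    (fun τ τ' h h' => (solves_append.2 ⟨h, h'⟩).consistent)
    (fun v hv => hθ.exists_mem_vertexRel hσ (hvs v hv)) R hR
  exact List.ne_nil_of_mem hτ

variable {Q : Query} {H : Hypertree}

theorem subst_mem_facts_of_matchable {A : Atom} (hA : matchable facts τ A)
    (hlen : ∀ f ∈ facts, A.rel = f.rel → A.args.length = f.args.length)
    (hval : ∀ x ∈ A.vars, ∃ a, (Term.var x, a) ∈ τ) (hθ : Solves θ τ) : A.subst θ ∈ facts := by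
  obtain ⟨f, hf, hr, hc⟩ := matchable_iff.1 hA
  obtain ⟨θ', hθ'⟩ := exists_solves_of_consistent hc
  obtain ⟨hzip, hτ⟩ := solves_append.1 hθ'
  have hagree : ∀ x ∈ A.vars, θ x = θ' x := fun x hx => by
    obtain ⟨a, ha⟩ := hval x hx
    exact (hθ _ ha).trans (hτ _ ha).symm
  rwa [Atom.subst_congr hagree, (solves_zip_args_iff hr (hlen f hf hr)).1 hzip]

theorem exists_isMatch_of_satisfiable
    (hlen : ∀ A ∈ Q.body, ∀ f ∈ facts, A.rel = f.rel → A.args.length = f.args.length)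
    (hH : H.IsGeneralizedDecomposition Q) (hk : H.width ≤ k)
    (h : satisfiable k facts Q.body H.labels σ) : ∃ θ, IsMatch θ Q.body facts ∧ Solves θ σ := by
  obtain ⟨hσ, hne⟩ := satisfiable_iff.1 h
  obtain ⟨τ, hτ⟩ := Hypertree.exists_choice_semijoins hne
  have hrel p := (mem_vertexRel.1 (hτ p).1).2
  have hself p : consistent (τ p) :=
    (exists_solves_of_consistent (hrel p).1).elim fun _ h => (solves_append.1 h).1.consistent
  have hval : ∀ p, ∀ x ∈ H.chi p, ∃ a, (Term.var x, a) ∈ τ p := fun p x hx => by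
    obtain ⟨A, hA, hxA⟩ := Set.mem_iUnion₂.1 (hH.chi_subset p hx)
    exact exists_value_of_mem_vertexRel (H.dedup_lamList_length_le hk p) (hτ p).1
      (List.mem_toFinset.1 hA) (hlen A (List.mem_toFinset.1 ((hH.isHypertree p).2 hA)))
      (List.mem_toFinset.1 hx) hxA
  have hpair := hH.consistent_append
    (fun p e he => by simpa [Hypertree.chi] using exists_eq_var_of_mem_vertexRel (hτ p).1 he)
    hval hself fun p => (hτ p).2
  obtain ⟨θ, hθ⟩ : ∃ θ, Solves θ (σ :: List.ofFn τ).flatten := by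
    refine exists_solves_of_consistent (consistent_flatten ?_)
    simp only [List.forall_mem_cons, List.forall_mem_ofFn_iff]
    refine ⟨⟨consistent_append hσ hσ fun p hp q hq => (consistent_iff_forall.1 hσ p hp).2 q hq,
      fun p => consistent_append_comm.1 (hrel p).1⟩, fun p => ⟨(hrel p).1, hpair p⟩⟩
  have hθτ p : Solves θ (τ p) := fun e he =>
    hθ e (List.mem_flatten_of_mem (List.mem_cons_of_mem _ (List.mem_ofFn.2 ⟨p, rfl⟩)) he)
  refine ⟨θ, fun A hA => ?_, (solves_append.1 hθ).1⟩
  obtain ⟨p, hp⟩ := hH.covers A (List.mem_toFinset.2 hA)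
  exact subst_mem_facts_of_matchable ((hrel p).2 A hA) (hlen A hA)
    (fun x hx => hval p x (hp hx)) (hθτ p)

/-! ### Enumerating the answer -/

/-- The values that a term may take under substitutions into `dom`. -/
def termValues (dom : List ℕ) (t : Term) : List ℕ := if t.isVar then dom.dedup else [t.name]

/-- The evaluations of a list of terms in `dom`, extended from the last term to the first; only
those partial evaluations survive that pass the test. -/
def evaluations (test : Equations → Bool) (dom : List ℕ) (ts : List Term) : List Equations :=
  ts.foldr (fun t L => L.flatMap fun σ => ((termValues dom t).map fun v => (t, v) :: σ).filter test)
    (if test [] then [[]] else [])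

/-- The list of the tuples that are obtained from the evaluations of `ts`. -/
def answerList (test : Equations → Bool) (dom : List ℕ) (ts : List Term) : List (List ℕ) :=
  (evaluations test dom ts).map fun σ => σ.map Prod.snd

/-- The equations `t = tθ` for the terms `t` in the list. -/
def equationsOf (θ : ℕ → ℕ) (ts : List Term) : Equations := ts.map fun t => (t, t.subst θ)

section Evaluations

variable {test : Equations → Bool} {dom : List ℕ} {ts : List Term} {σ : Equations}

theorem nodup_termValues (dom : List ℕ) (t : Term) : (termValues dom t).Nodup := by
  unfold termValues
  split
  exacts [List.nodup_dedup _, List.nodup_singleton _]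

theorem subst_mem_termValues {θ : ℕ → ℕ} {t : Term} :
    t.subst θ ∈ termValues dom t ↔ ∀ x, t = .var x → θ x ∈ dom := by
  cases t <;> simp [termValues, Term.isVar, Term.name, Term.subst]

theorem forall_subst_mem_termValues {θ : ℕ → ℕ} :
    (∀ t ∈ ts, t.subst θ ∈ termValues dom t) ↔ ∀ x ∈ varsOf ts, θ x ∈ dom := by
  simp only [subst_mem_termValues]
  exact ⟨fun h x hx => h _ hx x rfl, by rintro h _ ht x rfl; exact h x ht⟩

theorem evaluations_cons (test : Equations → Bool) (dom : List ℕ) (t : Term) (ts : List Term) :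
    evaluations test dom (t :: ts) = (evaluations test dom ts).flatMap
      fun σ => ((termValues dom t).map fun v => (t, v) :: σ).filter test := rfl

theorem mem_evaluations (htest : ∀ p σ, test (p :: σ) → test σ) :
    σ ∈ evaluations test dom ts ↔
      test σ ∧ σ.map Prod.fst = ts ∧ ∀ p ∈ σ, p.2 ∈ termValues dom p.1 := by
  induction ts generalizing σ with
  | nil => cases h : test [] <;> cases σ <;> simp [evaluations, h]
  | cons t ts ih =>
    simp only [evaluations_cons, List.mem_flatMap, List.mem_filter, List.mem_map, ih]
    cases σ with
    | nil => simp
    | cons p σ =>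
      simp only [List.map_cons, List.cons.injEq, List.forall_mem_cons]
      constructor
      · rintro ⟨σ, ⟨-, rfl, hσ⟩, ⟨v, hv, rfl, rfl⟩, ht⟩
        exact ⟨ht, ⟨rfl, rfl⟩, hv, hσ⟩
      · rintro ⟨ht, ⟨rfl, rfl⟩, hv, hσ⟩
        exact ⟨σ, ⟨htest p σ ht, rfl, hσ⟩, ⟨p.2, hv, rfl, rfl⟩, ht⟩

theorem nodup_evaluations (test : Equations → Bool) (dom : List ℕ) (ts : List Term) :
    (evaluations test dom ts).Nodup := by
  induction ts with
  | nil =>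
    simp only [evaluations, List.foldr_nil]
    split <;> simp
  | cons t ts ih =>
    rw [evaluations_cons, List.nodup_flatMap]
    refine ⟨fun σ _ => .filter _ ((nodup_termValues dom t).map fun v w h => by simpa using h),
      ih.imp fun {σ σ'} hne ρ h h' => ?_⟩
    simp only [List.mem_filter, List.mem_map] at h h'
    obtain ⟨⟨v, -, rfl⟩, -⟩ := h
    obtain ⟨⟨w, -, h⟩, -⟩ := h'
    exact hne (List.cons.inj h).2.symm

theorem length_evaluations_nil_le : (evaluations test [] ts).length ≤ 1 := by
  induction ts with
  | nil =>
    simp only [evaluations, List.foldr_nil]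
    split <;> simp
  | cons t ts ih =>
    rw [evaluations_cons, List.length_flatMap]
    refine (List.sum_le_card_nsmul _ 1 ?_).trans (by simpa using ih)
    simp only [List.forall_mem_map]
    refine fun σ _ => (List.length_filter_le _ _).trans ?_
    cases t <;> simp [termValues, Term.isVar]

end Evaluations

section Answer

variable {test : Equations → Bool} {DB : Database} {Q : Query}

theorem solves_and_map_fst_iff {θ : ℕ → ℕ} {ts : List Term} {σ : Equations} :
    Solves θ σ ∧ σ.map Prod.fst = ts ↔ σ = equationsOf θ ts := by
  constructor
  · rintro ⟨h, rfl⟩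
    rw [equationsOf, List.map_map]
    exact (σ.map_id.symm.trans (List.map_congr_left fun p hp => Prod.ext rfl (h p hp).symm))
  · rintro rfl
    exact ⟨List.forall_mem_map.2 fun _ _ => rfl, by simp [equationsOf, Function.comp_def]⟩

theorem mem_evaluations_iff_exists_isMatch
    (htest : ∀ σ, test σ ↔ ∃ θ, IsMatch θ Q.body DB.facts ∧ Solves θ σ) {ts : List Term}
    {σ : Equations} : σ ∈ evaluations test DB.dom ts ↔ ∃ θ, IsMatch θ Q.body DB.facts ∧
      (∀ x ∈ varsOf ts, θ x ∈ DB.dom) ∧ σ = equationsOf θ ts := by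
  rw [mem_evaluations]
  · simp only [htest, ← forall_subst_mem_termValues]
    constructor
    · rintro ⟨⟨θ, hθ, hσ⟩, rfl, hd⟩
      refine ⟨θ, hθ, List.forall_mem_map.2 fun p hp => hσ p hp ▸ hd p hp, ?_⟩
      exact solves_and_map_fst_iff.1 ⟨hσ, rfl⟩
    · rintro ⟨θ, hθ, hd, rfl⟩
      obtain ⟨hσ, hfst⟩ := solves_and_map_fst_iff.2 (Eq.refl (equationsOf θ ts))
      exact ⟨⟨θ, hθ, hσ⟩, hfst, List.forall_mem_map.2 hd⟩
  · exact fun p σ h => (htest σ).2 (((htest _).1 h).imp fun θ hθ =>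
      ⟨hθ.1, (List.forall_mem_cons.1 hθ.2).2⟩)

theorem mem_dom_of_subst_mem_facts (hDB : ∀ f ∈ DB.facts, ∀ a ∈ f.args, a ∈ DB.dom) {A : Atom}
    {θ : ℕ → ℕ} (hA : A.subst θ ∈ DB.facts) {x : ℕ} (hx : x ∈ A.vars) : θ x ∈ DB.dom :=
  hDB _ hA _ (List.mem_map_of_mem (f := Term.subst θ) hx)

theorem IsMatch.mem_answer {θ : ℕ → ℕ} (hDB : ∀ f ∈ DB.facts, ∀ a ∈ f.args, a ∈ DB.dom)
    (hθ : IsMatch θ Q.body DB.facts) (hd : ∀ x ∈ varsOf Q.head, θ x ∈ DB.dom) :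
    Q.head.map (Term.subst θ) ∈ Q.answer DB := by
  have hθ' : ∀ A ∈ Q.atoms, A.subst θ ∈ DB.facts := fun A hA => hθ A (List.mem_toFinset.1 hA)
  refine ⟨θ, ?_, hθ', rfl⟩
  rintro x (hx | hx)
  · exact hd x hx
  · obtain ⟨A, hA, hxA⟩ := Set.mem_iUnion₂.1 hx
    exact mem_dom_of_subst_mem_facts hDB (hθ' A hA) hxA

theorem enumerates_answerList (hDB : ∀ f ∈ DB.facts, ∀ a ∈ f.args, a ∈ DB.dom)
    (htest : ∀ σ, test σ ↔ ∃ θ, IsMatch θ Q.body DB.facts ∧ Solves θ σ) :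
    Enumerates (answerList test DB.dom Q.head) (Q.answer DB) := by
  refine ⟨List.Nodup.map_on (fun σ hσ σ' hσ' h => ?_) (nodup_evaluations _ _ _), fun t => ?_⟩
  · obtain ⟨θ, -, -, rfl⟩ := (mem_evaluations_iff_exists_isMatch htest).1 hσ
    obtain ⟨θ', -, -, rfl⟩ := (mem_evaluations_iff_exists_isMatch htest).1 hσ'
    simp only [equationsOf, List.map_map, List.map_inj_left, Function.comp_apply] at h
    exact List.map_congr_left fun t ht => by rw [h t ht]
  · simp only [answerList, List.mem_map, mem_evaluations_iff_exists_isMatch htest]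
    constructor
    · rintro ⟨_, ⟨θ, hθ, hd, rfl⟩, rfl⟩
      rw [equationsOf, List.map_map]
      exact hθ.mem_answer hDB hd
    · rintro ⟨θ, hd, hθ, rfl⟩
      exact ⟨_, ⟨θ, fun A hA => hθ A (List.mem_toFinset.2 hA), fun x hx => hd x (.inl hx), rfl⟩,
        by simp [equationsOf, Function.comp_def]⟩

/-- Changing the values outside the universe affects neither the atoms, whose instances are facts,
nor terms with values in the universe: so every partial evaluation extends to more terms. -/
theorem length_evaluations_le_append (hDB : ∀ f ∈ DB.facts, ∀ a ∈ f.args, a ∈ DB.dom)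
    (htest : ∀ σ, test σ ↔ ∃ θ, IsMatch θ Q.body DB.facts ∧ Solves θ σ) (hne : DB.dom ≠ [])
    (us ts : List Term) :
    (evaluations test DB.dom ts).length ≤ (evaluations test DB.dom (us ++ ts)).length := by
  obtain ⟨d, hd⟩ := List.exists_mem_of_ne_nil _ hne
  suffices evaluations test DB.dom ts ⊆
      (evaluations test DB.dom (us ++ ts)).map (List.drop us.length) by
    simpa using ((nodup_evaluations test DB.dom ts).subperm this).length_le
  intro σ hσ
  obtain ⟨θ, hθ, hts, rfl⟩ := (mem_evaluations_iff_exists_isMatch htest).1 hσ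
  let θ' (x : ℕ) : ℕ := if θ x ∈ DB.dom then θ x else d
  have hθ' {x} (hx : θ x ∈ DB.dom) : θ' x = θ x := if_pos hx
  refine List.mem_map.2 ⟨equationsOf θ' (us ++ ts),
    (mem_evaluations_iff_exists_isMatch htest).2 ⟨θ', fun A hA => ?_, fun x _ => ?_, rfl⟩, ?_⟩
  · rw [Atom.subst_congr fun x hx => hθ' (mem_dom_of_subst_mem_facts hDB (hθ A hA) hx)]
    exact hθ A hA
  · dsimp only [θ']
    split <;> assumption
  · rw [equationsOf, List.map_append, List.drop_left' (List.length_map _)]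
    refine List.map_congr_left ?_
    rintro (x | c) hx
    exacts [congrArg (Prod.mk _) (hθ' (hts x hx)), rfl]

theorem length_evaluations_le_add_one (hDB : ∀ f ∈ DB.facts, ∀ a ∈ f.args, a ∈ DB.dom)
    (htest : ∀ σ, test σ ↔ ∃ θ, IsMatch θ Q.body DB.facts ∧ Solves θ σ) {ts ts' : List Term}
    (h : ts <:+ ts') :
    (evaluations test DB.dom ts).length ≤ (evaluations test DB.dom ts').length + 1 := by
  obtain ⟨us, rfl⟩ := h
  by_cases hdom : DB.dom = []
  · rw [hdom]
    exact length_evaluations_nil_le.trans (Nat.le_add_left _ _)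
  · exact (length_evaluations_le_append hDB htest hdom us ts).trans (Nat.le_add_right _ _)

end Answer

end ConjQuery

namespace StackProgram

open Coded

open Polynomial (X)

/-! ### Faithful encodings -/

/-- Types whose elements are determined by their encodings, so that equality can be decided. -/
class InjectiveEncoding (α : Type) [Coded α] : Prop where
  encode_injective : Function.Injective (encode : α → Data)

/-- Types whose weight charges for the encoding only, so that any function into them is polynomial
as soon as its encoded values are. -/
class ExactWeight (α : Type) [Coded α] : Prop where
  weight_eq_size : ∀ a : α, weight a = (encode a).size

open InjectiveEncoding (encode_injective)

instance : InjectiveEncoding Data := ⟨fun _ _ h => h⟩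

instance : ExactWeight Data := ⟨fun _ => rfl⟩

instance : InjectiveEncoding Bool := ⟨by decide⟩

instance : ExactWeight Bool := ⟨fun _ => rfl⟩

instance {α : Type} [Coded α] [InjectiveEncoding α] : InjectiveEncoding (List α) where
  encode_injective l l' h := by
    induction l generalizing l' with
    | nil => cases l' <;> simp_all
    | cons x l ih =>
      cases l' with
      | nil => simp at h
      | cons y l' =>
        simp only [encode_cons, Data.node.injEq] at h
        rw [encode_injective h.1, ih l' h.2]

instance {α : Type} [Coded α] [ExactWeight α] : ExactWeight (List α) where
  weight_eq_size l := by
    induction l with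
    | nil => rfl
    | cons x l ih => rw [weight_cons, encode_cons, Data.size, ExactWeight.weight_eq_size, ih]

instance {α β : Type} [Coded α] [Coded β] [ExactWeight α] [ExactWeight β] :
    ExactWeight (α × β) where
  weight_eq_size p := by
    rw [weight_prod, encode_prod, Data.size, ExactWeight.weight_eq_size, ExactWeight.weight_eq_size]

/-- The encoding of a type through a function to a coded type. -/
abbrev Coded.ofMap {α β : Type} [Coded β] (f : α → β) : Coded α where
  encode a := encode (f a)
  weight a := (encode (f a)).size
  size_encode_le _ := le_rfl

section

variable {α β γ : Type} [Coded α] [Coded β] [Coded γ]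

@[simp] theorem encode_map_encode (l : List α) : encode (l.map encode) = encode l := by
  induction l with
  | nil => rfl
  | cons x l ih => simp only [List.map_cons, encode_cons, ih]; rfl

@[fun_prop]
theorem PolyTime.decide_eq [DecidableEq β] [InjectiveEncoding β] {f g : α → β} (hf : PolyTime f)
    (hg : PolyTime g) : PolyTime fun a => decide (f a = g a) := by
  simpa only [encode_injective.eq_iff] using hf.decide_encode_eq hg

theorem PolyTime.of_encode [ExactWeight γ] {f : α → β} {g : α → γ} (hf : PolyTime f)
    (h : ∀ a, encode (g a) = encode (f a)) : PolyTime g := by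
  obtain ⟨q, hq⟩ := hf.exists_weight_le
  refine hf.congr_encode h q fun a => ?_
  rw [ExactWeight.weight_eq_size, h]
  exact (size_encode_le _).trans (hq a)

theorem PolyTime.encode {f : α → β} (hf : PolyTime f) : PolyTime fun a => Coded.encode (f a) :=
  hf.of_encode fun _ => rfl

@[fun_prop]
theorem PolyTime.headD {f : α → List β} (d : β) (hf : PolyTime f) :
    PolyTime fun a => (f a).headD d := by
  have h : PolyTime fun a => match f a with
      | [] => d
      | x :: _ => x := .listCases hf (by fun_prop) (by fun_prop)
  convert h using 2 with a
  cases f a <;> rfl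

@[fun_prop]
theorem PolyTime.tail {f : α → List β} (hf : PolyTime f) : PolyTime fun a => (f a).tail := by
  have h : PolyTime fun a => match f a with
      | [] => []
      | _ :: l => l := .listCases hf (by fun_prop) (by fun_prop)
  convert h using 2 with a
  cases f a <;> rfl

@[fun_prop]
theorem PolyTime.getD {f : α → List β} (i : ℕ) (d : β) (hf : PolyTime f) :
    PolyTime fun a => (f a).getD i d := by
  induction i generalizing f with
  | zero =>
    convert hf.headD d using 2 with a
    cases f a <;> rfl
  | succ i ih =>
    convert ih hf.tail using 2 with a
    cases f a <;> rfl

@[fun_prop]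
theorem PolyTime.dedup [DecidableEq β] [InjectiveEncoding β] {f : α → List β} (hf : PolyTime f) :
    PolyTime fun a => (f a).dedup := by
  have hmem : PolyTime fun p : α × β × List β => p.2.2.any fun y => decide (y = p.2.1) :=
    .any (by fun_prop) (by fun_prop)
  have h : PolyTime fun a => (f a).foldr
      (fun x l => if l.any fun y => decide (y = x) then l else x :: l) [] :=
    .foldr hf (by fun_prop) (hmem.ite (by fun_prop) (by fun_prop)) (X + 1) fun _ x l => by
      split
      · exact Nat.le_add_right _ _
      · simp; lia
  convert h using 2 with a
  induction f a with
  | nil => rfl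
  | cons x l ih =>
    rw [List.foldr_cons, ← ih]
    by_cases hx : x ∈ l <;> simp [hx]

end

/-! ### Encoding of queries and databases -/

open ConjQuery Computability

instance : Coded ℕ := .ofMap encodeNat

instance : ExactWeight ℕ := ⟨fun _ => rfl⟩

instance : InjectiveEncoding ℕ :=
  ⟨fun _ _ h => Function.LeftInverse.injective decode_encodeNat (encode_injective h)⟩

@[fun_prop]
theorem PolyTime.encodeNat : PolyTime fun n : ℕ => encodeNat n :=
  PolyTime.id.of_encode fun _ => rfl

/-- The binary representation of a term, with a leading tag bit that is set for constants. -/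
def termBits (t : Term) : List Bool := (!t.isVar) :: Computability.encodeNat t.name

instance : Coded Term := .ofMap termBits

instance : ExactWeight Term := ⟨fun _ => rfl⟩

theorem termBits_injective : Function.Injective termBits := by
  intro s t h
  obtain ⟨hvar, hname⟩ := List.cons.inj h
  have := Function.LeftInverse.injective decode_encodeNat hname
  cases s <;> cases t <;> simp_all [Term.isVar, Term.name]

instance : InjectiveEncoding Term := ⟨fun _ _ h => termBits_injective (encode_injective h)⟩

@[fun_prop]
theorem PolyTime.termBits : PolyTime fun t : Term => termBits t :=
  PolyTime.id.of_encode fun _ => rfl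

@[fun_prop]
theorem PolyTime.isVar : PolyTime fun t : Term => t.isVar := by
  have h : PolyTime fun t : Term => !(StackProgram.termBits t).headD false := by fun_prop
  simpa [StackProgram.termBits] using h

@[fun_prop]
theorem PolyTime.name : PolyTime fun t : Term => t.name := by
  have h : PolyTime fun t : Term => (StackProgram.termBits t).tail := by fun_prop
  exact h.of_encode fun _ => rfl

@[fun_prop]
theorem PolyTime.var : PolyTime fun x : ℕ => Term.var x := by
  have h : PolyTime fun x : ℕ => false :: Computability.encodeNat x := by fun_prop
  exact h.of_encode fun _ => rfl

/-- The pair of the components of a fact, as a list of two trees. -/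
def factFields (f : Fact) : List Data := [encode f.rel, encode f.args]

instance : Coded Fact := .ofMap factFields

instance : ExactWeight Fact := ⟨fun _ => rfl⟩

@[fun_prop]
theorem PolyTime.factFields : PolyTime fun f : Fact => factFields f :=
  PolyTime.id.of_encode fun _ => rfl

@[fun_prop]
theorem PolyTime.factRel : PolyTime fun f : Fact => f.rel := by
  have h : PolyTime fun f : Fact => (StackProgram.factFields f).getD 0 .nil := by fun_prop
  exact h.of_encode fun _ => rfl

@[fun_prop]
theorem PolyTime.factArgs : PolyTime fun f : Fact => f.args := by
  have h : PolyTime fun f : Fact => (StackProgram.factFields f).getD 1 .nil := by fun_prop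
  exact h.of_encode fun _ => rfl

/-- The pair of the components of an atom, as a list of two trees. -/
def atomFields (A : Atom) : List Data := [encode A.rel, encode A.args]

instance : Coded Atom := .ofMap atomFields

instance : ExactWeight Atom := ⟨fun _ => rfl⟩

theorem atomFields_injective : Function.Injective atomFields := by
  rintro ⟨r, ts⟩ ⟨r', ts'⟩ h
  simp only [atomFields, List.cons.injEq, and_true, encode_injective.eq_iff] at h
  rw [h.1, h.2]

instance : InjectiveEncoding Atom := ⟨fun _ _ h => atomFields_injective (encode_injective h)⟩

@[fun_prop]
theorem PolyTime.atomFields : PolyTime fun A : Atom => atomFields A :=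
  PolyTime.id.of_encode fun _ => rfl

@[fun_prop]
theorem PolyTime.atomRel : PolyTime fun A : Atom => A.rel := by
  have h : PolyTime fun A : Atom => (StackProgram.atomFields A).getD 0 .nil := by fun_prop
  exact h.of_encode fun _ => rfl

@[fun_prop]
theorem PolyTime.atomArgs : PolyTime fun A : Atom => A.args := by
  have h : PolyTime fun A : Atom => (StackProgram.atomFields A).getD 1 .nil := by fun_prop
  exact h.of_encode fun _ => rfl

/-! ### The query evaluation algorithm runs in polynomial time -/

@[fun_prop]
theorem PolyTime.consistent : PolyTime fun σ : Equations => consistent σ :=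
  .all (by fun_prop) (.and (by fun_prop) (.all (by fun_prop) (by fun_prop)))

theorem PolyTime.matchings (k : ℕ) :
    PolyTime fun p : List Fact × List Atom => matchings p.1 k p.2 := by
  induction k with
  | zero => exact .const _
  | succ k ih =>
    have hrec : PolyTime fun p : ((List Fact × List Atom) × Atom × List Atom) × Fact =>
        ConjQuery.matchings p.1.1.1 k p.1.2.2 :=
      ih.comp (f := fun p : ((List Fact × List Atom) × Atom × List Atom) × Fact =>
        (p.1.1.1, p.1.2.2)) (by fun_prop)
    have hstep : PolyTime fun p : ((List Fact × List Atom) × Atom × List Atom) × Fact =>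
        if decide (p.1.2.1.rel = p.2.rel) then
          (ConjQuery.matchings p.1.1.1 k p.1.2.2).map fun τ => p.1.2.1.args.zip p.2.args ++ τ
        else [] :=
      .ite (by fun_prop) (.map hrec (by fun_prop)) (by fun_prop)
    have h := PolyTime.listCases (f := fun p : List Fact × List Atom => p.2)
      (g := fun _ => ([[]] : List Equations))
      (h := fun p A As => p.1.flatMap fun f : Fact => if decide (A.rel = f.rel) then
        (ConjQuery.matchings p.1 k As).map fun τ => A.args.zip f.args ++ τ else [])
      .snd (by fun_prop) (.flatMap (by fun_prop) hstep)
    convert h using 2 with p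
    obtain ⟨facts, _ | ⟨A, As⟩⟩ := p <;> rfl

section

variable {α β γ : Type} [Coded α] [Coded β] [Coded γ]

theorem PolyTime.semijoins {l : α → List β} {rel : α → β → List γ} {ok : γ → γ → Bool}
    (hl : PolyTime l) (hrel : PolyTime fun p : α × β => rel p.1 p.2)
    (hok : PolyTime fun p : γ × γ => ok p.1 p.2) :
    PolyTime fun a => semijoins (rel a) ok (l a) := by
  obtain ⟨q, hq⟩ := hrel.exists_weight_le
  have hrel' : PolyTime fun p : α × β × List (List γ) => rel p.1 p.2.1 :=
    hrel.comp (f := fun p : α × β × List (List γ) => (p.1, p.2.1)) (by fun_prop)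
  have hok' : PolyTime fun p : (((α × β × List (List γ)) × γ) × List γ) × γ => ok p.1.1.2 p.2 :=
    hok.comp (f := fun p : (((α × β × List (List γ)) × γ) × List γ) × γ => (p.1.1.2, p.2))
      (by fun_prop)
  refine .foldr hl (by fun_prop)
    (.cons (.filter hrel' (.all (by fun_prop) (.any (by fun_prop) hok'))) (by fun_prop))
    (q.comp (X + 1) + 1) fun a v Rs => ?_
  have hv := hq (a, v)
  have hfilter := weight_le_of_sublist
    (List.filter_sublist (p := fun t => Rs.all fun R => R.any fun t' => ok t t') (l := rel a v))
  simp only [weight_prod, weight_cons, Polynomial.eval_add, Polynomial.eval_comp, Polynomial.eval_X,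
    Polynomial.eval_one] at hv ⊢
  lia

@[fun_prop]
theorem PolyTime.restrict {xs : α → List ℕ} {τ : α → Equations} (hx : PolyTime xs)
    (hτ : PolyTime τ) : PolyTime fun a => restrict (xs a) (τ a) :=
  .filter hτ (.any (by fun_prop) (by fun_prop))

@[fun_prop]
theorem PolyTime.matchable {facts : α → List Fact} {τ : α → Equations} {A : α → Atom}
    (hf : PolyTime facts) (hτ : PolyTime τ) (hA : PolyTime A) :
    PolyTime fun a => matchable (facts a) (τ a) (A a) :=
  .any hf (by fun_prop)

theorem PolyTime.vertexRel (k : ℕ) {facts : α → List Fact} {body : α → List Atom}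
    {σ : α → Equations} {v : α → List ℕ × List Atom} (hf : PolyTime facts) (hb : PolyTime body)
    (hσ : PolyTime σ) (hv : PolyTime v) :
    PolyTime fun a => vertexRel k (facts a) (body a) (σ a) (v a) := by
  have hmatchings : PolyTime fun a => ConjQuery.matchings (facts a) k (v a).2.dedup :=
    (PolyTime.matchings k).comp (f := fun a => (facts a, (v a).2.dedup)) (by fun_prop)
  exact .filter (.map hmatchings (by fun_prop)) (.and (by fun_prop) (.all (by fun_prop)
    (by fun_prop)))

theorem PolyTime.satisfiable (k : ℕ) {facts : α → List Fact} {body : α → List Atom}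
    {vs : α → List (List ℕ × List Atom)} {σ : α → Equations} (hf : PolyTime facts)
    (hb : PolyTime body) (hvs : PolyTime vs) (hσ : PolyTime σ) :
    PolyTime fun a => satisfiable k (facts a) (body a) (vs a) (σ a) :=
  .and (by fun_prop) (.all (.semijoins hvs (.vertexRel k (by fun_prop) (by fun_prop) (by fun_prop)
    (by fun_prop)) (by fun_prop)) (by fun_prop))

@[fun_prop]
theorem PolyTime.termValues {dom : α → List ℕ} {t : α → Term} (hd : PolyTime dom)
    (ht : PolyTime t) : PolyTime fun a => termValues (dom a) (t a) := by
  unfold ConjQuery.termValues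
  fun_prop

theorem PolyTime.evaluations {test : α → Equations → Bool} {dom : α → List ℕ}
    {ts : α → List Term} (htest : PolyTime fun p : α × Equations => test p.1 p.2)
    (hd : PolyTime dom) (ht : PolyTime ts) (q : Polynomial ℕ)
    (hq : ∀ a l, l <:+ ts a → weight (evaluations (test a) (dom a) l) ≤ q.eval (weight a)) :
    PolyTime fun a => evaluations (test a) (dom a) (ts a) := by
  have htest_nil : PolyTime fun a => test a [] := htest.comp (f := fun a => (a, [])) (by fun_prop)
  have htest' : PolyTime fun p : ((α × Term × List Equations) × Equations) × Equations =>
      test p.1.1.1 p.2 :=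
    htest.comp (f := fun p : ((α × Term × List Equations) × Equations) × Equations =>
      (p.1.1.1, p.2)) (by fun_prop)
  exact .foldr_of_bound ht (htest_nil.ite (by fun_prop) (by fun_prop))
    (.flatMap (by fun_prop) (.filter (.map (by fun_prop) (by fun_prop)) htest')) q hq

theorem PolyTime.answerList {test : α → Equations → Bool} {dom : α → List ℕ}
    {ts : α → List Term} (htest : PolyTime fun p : α × Equations => test p.1 p.2)
    (hd : PolyTime dom) (ht : PolyTime ts) (q : Polynomial ℕ)
    (hq : ∀ a l, l <:+ ts a →
      weight (ConjQuery.evaluations (test a) (dom a) l) ≤ q.eval (weight a)) :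
    PolyTime fun a => answerList (test a) (dom a) (ts a) :=
  .map (.evaluations htest hd ht q hq) (.map (by fun_prop) (by fun_prop))

end

/-! ### From polynomial-time functions on words to machines -/

/-- The number `n` as a tree, for the encoding of symbols. -/
def unary : ℕ → Data
  | 0 => .nil
  | n + 1 => .node .nil (unary n)

/-- The alphabet; a symbol is encoded by its position in this list. -/
def symbols : List Sym := [.bra, .ket, .comma, .bit false, .bit true, .blank]

instance : Coded Sym := .ofMap fun x => unary (symbols.idxOf x)

instance : InjectiveEncoding Sym := ⟨by decide⟩

theorem weight_sym_le (x : Sym) : weight x ≤ 11 := by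
  cases x with
  | bit b => cases b <;> decide
  | _ => decide

theorem mem_symbols (x : Sym) : x ∈ symbols := by
  cases x with
  | bit b => cases b <;> decide
  | _ => decide

theorem weight_word_le (w : List Sym) : weight w ≤ 12 * w.length + 1 := by
  have := weight_le_of_forall_mem (l := w) fun x _ => weight_sym_le x
  lia

/-- Removes a number `i` in unary notation from the top, and puts the symbol at position `i` of the
list on stack `b`. -/
def emit : List Sym → Prog Reg Sym
  | [] => .skip
  | x :: l => caseTop (.push .b x) (.seq dropTop (emit l))

theorem runs_emit (l : List Sym) (i : ℕ) (hi : i < l.length) (m b : List Sym) :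
    Runs (emit l) (regs ((unary i).code ++ m) [] b []) (regs m [] (l[i] :: b) [])
      (11 * i + 2) := by
  induction l generalizing i with
  | nil => simp at hi
  | cons x l ih =>
    cases i with
    | zero => exact runs_caseTop_nil (by simpa using Runs.push .b x (regs m [] b []))
    | succ i =>
      have h := (runs_dropTop .nil ((unary i).code ++ m) b).seq (ih i (by simpa using hi))
      refine (runs_caseTop_node h).mono ?_
      simp only [Data.size]
      lia

theorem runs_emit_symbols (x : Sym) (m b : List Sym) :
    Runs (emit symbols) (regs ((encode x).code ++ m) [] b []) (regs m [] (x :: b) []) 57 := by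
  have hi : symbols.idxOf x < symbols.length := List.idxOf_lt_length_of_mem (mem_symbols x)
  have h := runs_emit symbols _ hi m b
  rw [List.getElem_idxOf] at h
  exact h.mono (by simp only [symbols, List.length_cons, List.length_nil] at hi ⊢; lia)

/-- Removes the encoding of a word from the top, and puts the word itself on stack `a`. -/
def unload : Prog Reg Sym := .seq (whileTop (emit symbols)) (pour .b .a)

theorem runs_emitLoop (w m b : List Sym) :
    Runs (whileLoop (emit symbols)) (regs ((encode w).code ++ m) [] b [one])
      (regs m [] (w.reverse ++ b) []) (60 * w.length + 4) := by
  induction w generalizing b with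
  | nil => exact runs_whileLoop_nil _ m b
  | cons x w ih =>
    rw [List.reverse_cons, List.append_assoc]
    refine (runs_whileLoop_node (runs_emit_symbols x _ b) (ih (x :: b))).mono ?_
    simp only [List.length_cons]
    lia

theorem runs_unload (w : List Sym) :
    Runs unload (onMain (encode w).code) (regs [] w [] []) (62 * w.length + 6) := by
  have emit_w := runs_whileTop (runs_emitLoop w [] [])
  have reverse_w := runs_pour (k := .b) (k' := .a) (by simp) (regs [] [] w.reverse [])
  simp only [update_regs_a, update_regs_b, regs_a, regs_b, List.reverse_reverse, List.append_nil,
    List.length_reverse] at emit_w reverse_w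
  exact (emit_w.seq reverse_w).mono (by lia)

/-- Removes the word from stack `a`, and puts its encoding on top. -/
def load : Prog Reg Sym :=
  .seq (pour .a .b) <| .seq pushNil (.loop .b fun x => .seq (pushData (encode x)) consTop)

theorem runs_loadLoop (v w : List Sym) :
    Runs (.loop .b fun x => .seq (pushData (encode x)) consTop) (regs (encode w).code [] v [])
      (onMain (encode (v.reverse ++ w)).code) (24 * v.length + 1) := by
  induction v generalizing w with
  | nil => exact .loop_nil _ rfl
  | cons x v ih =>
    have push_x := runs_pushData (encode x) (encode w).code v
    have cons_x := runs_consTop (encode x) (encode w) [] v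
    rw [List.append_nil, List.append_nil] at cons_x
    rw [List.reverse_cons, List.append_assoc]
    refine (Runs.loop_cons (S := regs (encode w).code [] (x :: v) []) rfl
      (by simpa using push_x.seq cons_x) (ih (x :: w))).mono ?_
    have := (size_encode_le x).trans (weight_sym_le x)
    simp only [List.length_cons]
    lia

theorem runs_load (w : List Sym) :
    Runs load (regs [] w [] []) (onMain (encode w).code) (26 * w.length + 3) := by
  have reverse_w := runs_pour (k := .a) (k' := .b) (by simp) (regs [] w [] [])
  have load_w := runs_loadLoop w.reverse []
  simp only [update_regs_a, update_regs_b, regs_a, regs_b, List.reverse_reverse, List.append_nil,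
    List.length_reverse] at reverse_w load_w
  exact (reverse_w.seq ((runs_pushNil [] _).seq load_w)).mono (by lia)

theorem length_lt_size_encode {β : Type} [Coded β] (l : List β) : l.length < (encode l).size := by
  rw [← encode_map_encode, ← ExactWeight.weight_eq_size, ← List.length_map (as := l) encode]
  exact length_lt_weight _

theorem PolyTime.exists_exec {α : Type} [Coded α] {word f : α → List Sym}
    (hword : ∀ a, Coded.encode a = Coded.encode (word a)) (hf : PolyTime f) :
    ∃ (p : Prog Reg Sym) (q : Polynomial ℕ), ∀ a, ∃ t, t + 1 ≤ q.eval (weight a) ∧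
      Exec p (regs [] (word a) [] []) (regs [] (f a) [] []) t := by
  obtain ⟨p, q, hq, hp⟩ := hf
  refine ⟨.seq load (.seq p unload), 26 * X + 63 * q + 10, fun a => ?_⟩
  have run_p := hp a []
  have load_word := runs_load (word a)
  rw [List.append_nil, List.append_nil] at run_p
  rw [← hword] at load_word
  obtain ⟨t, ht, h⟩ := load_word.seq (run_p.seq (runs_unload (f a)))
  refine ⟨t, ?_, h⟩
  have hin : (word a).length < weight a :=
    (length_lt_size_encode (word a)).trans_le (hword a ▸ size_encode_le a)
  have hout := (length_lt_weight (f a)).trans_le (hq a)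
  simp only [Polynomial.eval_add, Polynomial.eval_mul, Polynomial.eval_X, Polynomial.eval_ofNat]
  lia

theorem PolyTime.exists_machine {α : Type} [Coded α] {word f : α → List Sym}
    (hword : ∀ a, Coded.encode a = Coded.encode (word a)) (hf : PolyTime f) :
    ∃ (M : Turing.TM2ComputableAux Sym Sym) (q : Polynomial ℕ), (∀ s, Finite (M.tm.Γ s)) ∧
      ∀ a, Nonempty (Turing.TM2OutputsInTime M.tm ((word a).map M.inputAlphabet.symm)
        (some ((f a).map M.outputAlphabet.symm)) (q.eval (weight a))) := by
  obtain ⟨p, q, hp⟩ := hf.exists_exec hword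
  refine ⟨⟨p.toFinTM2 .a .a, Equiv.refl _, Equiv.refl _⟩, q,
    fun _ => inferInstanceAs (Finite Sym), fun a => ?_⟩
  obtain ⟨t, ht, h⟩ := hp a
  have hregs (w : List Sym) : regs [] w [] [] = fun k => if k = .a then w else [] := by
    funext k
    cases k <;> rfl
  rw [hregs, hregs] at h
  have hM := h.outputsInTime ht
  rw [← List.map_id (word a), ← List.map_id (f a)] at hM
  exact hM

/-! ### Parsing -/

/-- Reads one symbol. The state consists of the list that is being read, of bits or of values, and
of the initial parts of the lists around it. -/
def parseStep (s : List (List Data)) (x : Sym) : List (List Data) :=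
  if decide (x = .bra) then [] :: [] :: s
  else if decide (x = .comma) then
    [] :: (s.tail.headD [] ++ [encode (s.headD [])]) :: s.tail.tail
  else if decide (x = .ket) then s.tail.headD [] :: s.tail.tail.tail
  else if decide (x = .blank) then s
  else (s.headD [] ++ [encode (decide (x = .bit true))]) :: s.tail

/-- The list of trees that is denoted by a word. -/
def parse (w : List Sym) : List Data := (w.foldl parseStep [[]]).headD []

theorem weight_parseStep_le (s : List (List Data)) (x : Sym) :
    weight (parseStep s x) ≤ weight s + 20 := by
  have hsplit (s : List (List Data)) : weight (s.headD []) + weight s.tail ≤ weight s + 1 := by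
    cases s with
    | nil => simp
    | cons l s => simp; lia
  have hs := hsplit s
  have hs_tail := hsplit s.tail
  have hs_tail_tail := hsplit s.tail.tail
  have happend_bit := weight_append (s.headD []) [encode (decide (x = .bit true))]
  have happend_list := weight_append (s.tail.headD []) [encode (s.headD [])]
  have hbit : weight (encode (decide (x = .bit true))) ≤ 3 :=
    (size_encode_le _).trans (weight_bool_le _)
  have hlist : weight (encode (s.headD [])) ≤ weight (s.headD []) := size_encode_le _
  simp only [weight_cons, weight_nil] at happend_bit happend_list
  unfold parseStep
  split_ifs <;> grind [weight_cons, weight_nil]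

theorem PolyTime.parse : PolyTime fun w => parse w := by
  have hlist : PolyTime fun p : List Sym × List (List Data) × Sym =>
      Coded.encode (p.2.1.headD []) := .encode (by fun_prop)
  have hbit : PolyTime fun p : List Sym × List (List Data) × Sym =>
      Coded.encode (decide (p.2.2 = .bit true)) := .encode (by fun_prop)
  have hstep : PolyTime fun p : List Sym × List (List Data) × Sym => parseStep p.2.1 p.2.2 :=
    .ite (by fun_prop) (by fun_prop) (.ite (by fun_prop) (by fun_prop) (.ite (by fun_prop)
      (by fun_prop) (.ite (by fun_prop) (by fun_prop) (by fun_prop))))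
  exact .headD _ (.foldl .id (.const _) hstep 20 fun _ s x => by
    simpa using weight_parseStep_le s x)

/-- Reading the word `w` from the start of a list produces the datum `d`. -/
def Parses (w : List Sym) (d : Data) : Prop :=
  ∃ l : List Data, encode l = d ∧ ∀ s, w.foldl parseStep ([] :: s) = l :: s

theorem Parses.parse_eq {w : List Sym} {l : List Data} (h : Parses w (encode l)) : parse w = l := by
  obtain ⟨l', hl', h⟩ := h
  rw [parse, h, List.headD_cons, encode_injective hl']

theorem foldl_parseStep_bits (bs : List Bool) (l : List Data) (s : List (List Data)) :
    (bs.map Computability.Γ'.bit).foldl parseStep (l :: s) = (l ++ bs.map encode) :: s := by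
  induction bs generalizing l with
  | nil => simp
  | cons b bs ih =>
    have hb : parseStep (l :: s) (.bit b) = (l ++ [encode b]) :: s := by simp [parseStep]
    rw [List.map_cons, List.foldl_cons, hb, ih, List.append_assoc, List.map_cons,
      List.singleton_append]

theorem parses_bits (bs : List Bool) : Parses (bs.map Computability.Γ'.bit) (encode bs) :=
  ⟨bs.map encode, encode_map_encode bs, fun s => foldl_parseStep_bits bs [] s⟩

theorem foldl_parseStep_items {ws : List (List Sym)} {ds : List Data}
    (h : List.Forall₂ Parses ws ds) (l : List Data) (s : List (List Data)) :
    (ws.flatMap fun w => w ++ [Computability.Γ'.comma]).foldl parseStep ([] :: l :: s) =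
      [] :: (l ++ ds) :: s := by
  induction h generalizing l with
  | nil => simp
  | @cons w d ws ds hw _ ih =>
    obtain ⟨l', rfl, hw⟩ := hw
    have hcomma : parseStep (l' :: l :: s) .comma = [] :: (l ++ [encode l']) :: s := by
      simp [parseStep]
    rw [List.flatMap_cons, List.foldl_append, List.foldl_append, hw, List.foldl_cons,
      List.foldl_nil, hcomma, ih, List.append_assoc, List.singleton_append]

theorem parses_bracket {ws : List (List Sym)} {ds : List Data} (h : List.Forall₂ Parses ws ds) :
    Parses (bracket ws) (encode ds) := by
  refine ⟨ds, rfl, fun s => ?_⟩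
  have hbra : parseStep ([] :: s) .bra = [] :: [] :: [] :: s := by simp [parseStep]
  rw [bracket, List.foldl_cons, List.foldl_append, hbra, foldl_parseStep_items h]
  simp [parseStep]

theorem parses_bracket_map {α : Type} [Coded α] {e : α → List Sym}
    (he : ∀ a, Parses (e a) (encode a)) (l : List α) :
    Parses (bracket (l.map e)) (encode l) := by
  rw [← encode_map_encode]
  refine parses_bracket (List.forall₂_map_left_iff.2 (List.forall₂_map_right_iff.2 ?_))
  exact List.forall₂_same.2 fun a _ => he a

theorem parses_encodeNumber (n : ℕ) : Parses (encodeNumber n) (encode n) := parses_bits _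

theorem parses_encodeNums (l : List ℕ) : Parses (encodeNums l) (encode l) :=
  parses_bracket_map parses_encodeNumber l

theorem parses_encodeTerm (t : Term) : Parses (encodeTerm t) (encode t) := by
  cases t <;> exact parses_bits (termBits _)

theorem parses_encodeTerms (l : List Term) : Parses (encodeTerms l) (encode l) :=
  parses_bracket_map parses_encodeTerm l

theorem parses_encodeFact (f : Fact) : Parses (encodeFact f) (encode f) :=
  parses_bracket (.cons (parses_encodeNumber _) (.cons (parses_encodeNums _) .nil))

theorem parses_encodeAtom (A : Atom) : Parses (encodeAtom A) (encode A) :=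
  parses_bracket (.cons (parses_encodeNumber _) (.cons (parses_encodeTerms _) .nil))

theorem parses_encodeAtoms (l : List Atom) : Parses (encodeAtoms l) (encode l) :=
  parses_bracket_map parses_encodeAtom l

/-- The vertices of a hypertree, each as the list of its parent and its two labels. -/
def hypertreeData (H : Hypertree) : List (List Data) :=
  List.ofFn fun p : Fin (H.n + 1) =>
    [encode (H.parent p : ℕ), encode (H.chiList p), encode (H.lamList p)]

theorem parses_encodeHypertree (H : Hypertree) :
    Parses (encodeHypertree H) (encode (hypertreeData H)) := by
  rw [← encode_map_encode, hypertreeData, List.map_ofFn]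
  refine parses_bracket (List.forall₂_iff_get.2 ⟨by simp, fun i _ _ => ?_⟩)
  rw [List.get_ofFn, List.get_ofFn]
  exact parses_bracket (.cons (parses_encodeNumber _) (.cons (parses_encodeNums _)
    (.cons (parses_encodeAtoms _) .nil)))

/-- The components of an input, in the order in which they are written. -/
def inputData (DB : Database) (Q : Query) (H : Hypertree) : List (List Data) :=
  [[encode DB.facts, encode DB.dom], [encode Q.head, encode Q.body],
    (hypertreeData H).map encode]

theorem parse_encodeInput (DB : Database) (Q : Query) (H : Hypertree) :
    parse (encodeInput DB Q H) = (inputData DB Q H).map encode := by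
  refine Parses.parse_eq (parses_bracket (.cons ?_ (.cons ?_ (.cons ?_ .nil))))
  · exact parses_bracket
      (.cons (parses_bracket_map parses_encodeFact _) (.cons (parses_encodeNums _) .nil))
  · exact parses_bracket (.cons (parses_encodeTerms _) (.cons (parses_encodeAtoms _) .nil))
  · rw [encode_map_encode]
    exact parses_encodeHypertree H

@[fun_prop]
theorem PolyTime.bracket : PolyTime fun ws : List (List Sym) => bracket ws := by
  unfold ConjQuery.bracket
  exact .cons (by fun_prop) (.append (.flatMap (by fun_prop) (by fun_prop)) (by fun_prop))

@[fun_prop]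
theorem PolyTime.encodeNumber : PolyTime fun n : ℕ => encodeNumber n := by
  have h : PolyTime fun n : ℕ => (Computability.encodeNat n).map fun b =>
      if b then Computability.Γ'.bit true else Computability.Γ'.bit false :=
    .map (by fun_prop) (by fun_prop)
  convert h using 2 with n
  exact List.map_congr_left fun b _ => by cases b <;> rfl

@[fun_prop]
theorem PolyTime.encodeNums : PolyTime fun l : List ℕ => encodeNums l :=
  PolyTime.bracket.comp (.map (by fun_prop) (by fun_prop))

theorem PolyTime.encodeRelation : PolyTime fun R : List (List ℕ) => encodeRelation R :=
  PolyTime.bracket.comp (.map (by fun_prop) (by fun_prop))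

end StackProgram

namespace ConjQuery

open StackProgram Coded

open Polynomial (X)

/-! ### Query evaluation -/

theorem length_le_length_bracket (ws : List (List Sym)) : ws.length ≤ (bracket ws).length := by
  have h : ws.length ≤ (ws.flatMap fun w => w ++ [Computability.Γ'.comma]).length := by
    induction ws with
    | nil => exact le_rfl
    | cons w ws ih =>
      simp only [List.flatMap_cons, List.length_append, List.length_cons, List.length_nil]
      lia
  simp only [bracket, List.length_cons, List.length_append]
  lia

theorem weight_name_le (t : Term) : weight t.name ≤ weight t :=
  Nat.le_succ_of_le (Nat.le_add_left (encode (Computability.encodeNat t.name)).size _)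

theorem weight_subst_le {t : Term} {θ : ℕ → ℕ} {dom : List ℕ}
    (h : ∀ x, t = .var x → θ x ∈ dom) : weight (t.subst θ) ≤ weight t + weight dom := by
  cases t with
  | var x => exact (weight_le_of_mem (h x rfl)).trans (Nat.le_add_left _ _)
  | const c => exact (weight_name_le (.const c)).trans (Nat.le_add_right _ _)

theorem weight_equationsOf_le {ts : List Term} {θ : ℕ → ℕ} {dom : List ℕ}
    (h : ∀ x ∈ varsOf ts, θ x ∈ dom) :
    weight (equationsOf θ ts) ≤ weight ts * (2 * weight ts + weight dom + 2) + 1 := by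
  refine (weight_le_of_forall_mem (n := 2 * weight ts + weight dom + 1) fun e he => ?_).trans ?_
  · obtain ⟨t, ht, rfl⟩ := List.mem_map.1 he
    have hterm := weight_le_of_mem ht
    have hvalue := weight_subst_le (t := t) (θ := θ) (dom := dom) (by rintro x rfl; exact h x ht)
    rw [weight_prod]
    lia
  · rw [equationsOf, List.length_map]
    gcongr
    exact (length_lt_weight ts).le

/-- The inputs to the evaluation problem for a fixed bound `k` on the width. -/
structure Input (k : ℕ) where
  S : Schema
  DB : Database
  Q : Query
  H : Hypertree
  db_isOver : DB.IsOver S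
  query_isOver : Q.IsOver S
  isGeneralizedDecomposition : H.IsGeneralizedDecomposition Q
  width_le : H.width ≤ k

namespace Input

variable {k : ℕ} (I : Input k)

/-- The input word of the machine. -/
def word : List Sym := encodeInput I.DB I.Q I.H

/-- Decides which partial answers extend to answers. -/
def test : Equations → Bool := satisfiable k I.DB.facts I.Q.body I.H.labels

/-- The output of the evaluation algorithm. -/
def answers : List (List ℕ) := answerList I.test I.DB.dom I.Q.head

theorem test_iff (σ : Equations) :
    I.test σ ↔ ∃ θ, IsMatch θ I.Q.body I.DB.facts ∧ Solves θ σ := by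
  constructor
  · refine exists_isMatch_of_satisfiable (fun A hA f hf h => ?_) I.isGeneralizedDecomposition
      I.width_le
    rw [(I.query_isOver A hA).2, (I.db_isOver f hf).2.1, h]
  · rintro ⟨θ, hθ, hσ⟩
    refine hθ.satisfiable hσ fun v hv A hA => ?_
    obtain ⟨p, rfl⟩ := List.mem_ofFn.1 hv
    exact List.mem_toFinset.1
      ((I.isGeneralizedDecomposition.isHypertree p).2 (List.mem_toFinset.2 hA))

theorem forall_mem_dom : ∀ f ∈ I.DB.facts, ∀ a ∈ f.args, a ∈ I.DB.dom :=
  fun f hf => (I.db_isOver f hf).2.2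

theorem enumerates_answers : Enumerates I.answers (I.Q.answer I.DB) :=
  enumerates_answerList I.forall_mem_dom I.test_iff

/-- The encoding is that of the input word. The weight also charges for the answer, since the
machine may take time polynomial in the size of the answer. -/
instance : Coded (Input k) where
  encode I := encode I.word
  weight I := 12 * (I.word.length + (encodeRelation I.answers).length) + 1
  size_encode_le I := by
    have := (size_encode_le I.word).trans (weight_word_le I.word)
    lia

theorem weight_eq : weight I = 12 * (I.word.length + (encodeRelation I.answers).length) + 1 := rfl

theorem polyTime_word : PolyTime fun I : Input k => I.word :=
  PolyTime.id.congr_encode (fun _ => rfl) X fun I => by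
    rw [Polynomial.eval_X]
    exact (weight_word_le I.word).trans (by rw [weight_eq]; lia)

theorem polyTime_inputData (i : ℕ) :
    PolyTime fun I : Input k => (inputData I.DB I.Q I.H).getD i [] := by
  have h : PolyTime fun I : Input k => (parse I.word).getD i .nil :=
    .getD i .nil (PolyTime.parse.comp polyTime_word)
  refine h.of_encode fun I => ?_
  rw [word, parse_encodeInput, ← encode_nil (α := Data), List.getD_map]
  rfl

@[fun_prop]
theorem polyTime_facts : PolyTime fun I : Input k => I.DB.facts :=
  ((polyTime_inputData 0).getD 0 .nil).of_encode fun _ => rfl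

@[fun_prop]
theorem polyTime_dom : PolyTime fun I : Input k => I.DB.dom :=
  ((polyTime_inputData 0).getD 1 .nil).of_encode fun _ => rfl

@[fun_prop]
theorem polyTime_head : PolyTime fun I : Input k => I.Q.head :=
  ((polyTime_inputData 1).getD 0 .nil).of_encode fun _ => rfl

@[fun_prop]
theorem polyTime_body : PolyTime fun I : Input k => I.Q.body :=
  ((polyTime_inputData 1).getD 1 .nil).of_encode fun _ => rfl

theorem polyTime_labels : PolyTime fun I : Input k => I.H.labels := by
  have hdata : PolyTime fun I : Input k => hypertreeData I.H :=
    (polyTime_inputData 2).of_encode fun I => (encode_map_encode (hypertreeData I.H)).symm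
  have h : PolyTime fun I : Input k =>
      (hypertreeData I.H).map fun r => (r.getD 1 .nil, r.getD 2 .nil) :=
    .map hdata (by fun_prop)
  refine h.of_encode fun I => ?_
  have hmap : I.H.labels.map encode = ((hypertreeData I.H).map fun r : List Data =>
      (r.getD 1 .nil, r.getD 2 .nil)).map encode := by
    simp only [Hypertree.labels, hypertreeData, List.map_ofFn]
    rfl
  rw [← encode_map_encode, hmap, encode_map_encode]

theorem polyTime_test : PolyTime fun p : Input k × Equations => p.1.test p.2 :=
  .satisfiable k (polyTime_facts.comp .fst) (polyTime_body.comp .fst)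
    (polyTime_labels.comp .fst) .snd

theorem length_answers_lt : I.answers.length < weight I := by
  have := length_le_length_bracket (I.answers.map encodeNums)
  rw [List.length_map, ← encodeRelation] at this
  rw [weight_eq]
  lia

theorem weight_evaluations_le {ts : List Term} (h : ts <:+ I.Q.head) :
    weight (evaluations I.test I.DB.dom ts) ≤ (weight I + 1) *
      (weight I.Q.head * (2 * weight I.Q.head + weight I.DB.dom + 2) + 2) + 1 := by
  have hlength : (evaluations I.test I.DB.dom ts).length ≤ weight I + 1 := by
    have hle := length_evaluations_le_add_one I.forall_mem_dom I.test_iff h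
    have hlt := I.length_answers_lt
    rw [answers, answerList, List.length_map] at hlt
    lia
  have hts : weight ts ≤ weight I.Q.head := weight_le_of_sublist h.sublist
  refine (weight_le_of_forall_mem
    (n := weight I.Q.head * (2 * weight I.Q.head + weight I.DB.dom + 2) + 1) fun σ hσ => ?_).trans
    (by gcongr)
  obtain ⟨θ, -, hdom, rfl⟩ := (mem_evaluations_iff_exists_isMatch I.test_iff).1 hσ
  exact (weight_equationsOf_le hdom).trans (by gcongr)

theorem polyTime_answers : PolyTime fun I : Input k => I.answers := by
  obtain ⟨q, hq⟩ := (polyTime_head (k := k)).exists_weight_le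
  obtain ⟨q', hq'⟩ := (polyTime_dom (k := k)).exists_weight_le
  refine .answerList polyTime_test (by fun_prop) (by fun_prop)
    ((X + 1) * (q * (2 * q + q' + 2) + 2) + 1) fun I l hl => ?_
  refine (I.weight_evaluations_le hl).trans ?_
  have hhead := hq I
  have hdom := hq' I
  simp only [Polynomial.eval_add, Polynomial.eval_mul, Polynomial.eval_X, Polynomial.eval_one,
    Polynomial.eval_ofNat]
  gcongr

end Input

end ConjQuery

theorem mainTheorem7_general (k : ℕ) :
    ∃ (M : Turing.TM2ComputableAux Computability.Γ' Computability.Γ') (time : Polynomial ℕ),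
      (∀ s : M.tm.K, Finite (M.tm.Γ s)) ∧
      ∀ (S : ConjQuery.Schema) (DB : ConjQuery.Database) (Q : ConjQuery.Query)
        (H : ConjQuery.Hypertree),
        DB.IsOver S → Q.IsOver S → H.IsGeneralizedDecomposition Q → H.width ≤ k →
        ∃ L : List (List ℕ), ConjQuery.Enumerates L (Q.answer DB) ∧
          Nonempty (Turing.TM2OutputsInTime M.tm
            ((ConjQuery.encodeInput DB Q H).map M.inputAlphabet.symm)
            (some ((ConjQuery.encodeRelation L).map M.outputAlphabet.symm))
            (time.eval ((ConjQuery.encodeInput DB Q H).length +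
              (ConjQuery.encodeRelation L).length))) := by
  obtain ⟨M, q, hfin, hM⟩ := StackProgram.PolyTime.exists_machine (word := ConjQuery.Input.word)
    (fun _ => rfl) (StackProgram.PolyTime.encodeRelation.comp
      (ConjQuery.Input.polyTime_answers (k := k)))
  refine ⟨M, q.comp (12 * Polynomial.X + 1), hfin, fun S DB Q H hDB hQ hH hk => ?_⟩
  let I : ConjQuery.Input k := ⟨S, DB, Q, H, hDB, hQ, hH, hk⟩
  refine ⟨I.answers, I.enumerates_answers, ?_⟩
  simp only [Polynomial.eval_comp, Polynomial.eval_add, Polynomial.eval_mul, Polynomial.eval_X,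
    Polynomial.eval_one, Polynomial.eval_ofNat]
  exact hM I

theorem mainTheorem7 (k : ℕ) (hk : 0 < k) :
    ∃ (M : Turing.TM2ComputableAux Computability.Γ' Computability.Γ') (time : Polynomial ℕ),
      (∀ s : M.tm.K, Finite (M.tm.Γ s)) ∧
      ∀ (S : ConjQuery.Schema) (DB : ConjQuery.Database) (Q : ConjQuery.Query)
        (H : ConjQuery.Hypertree),
        DB.IsOver S → Q.IsOver S → H.IsDecomposition Q → H.width ≤ k →
        ∃ L : List (List ℕ), ConjQuery.Enumerates L (Q.answer DB) ∧
          Nonempty (Turing.TM2OutputsInTime M.tm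
            ((ConjQuery.encodeInput DB Q H).map M.inputAlphabet.symm)
            (some ((ConjQuery.encodeRelation L).map M.outputAlphabet.symm))
            (time.eval ((ConjQuery.encodeInput DB Q H).length +
              (ConjQuery.encodeRelation L).length))) := by
  obtain ⟨M, time, hfin, hM⟩ := mainTheorem7_general k
  exact ⟨M, time, hfin, fun S DB Q H hDB hQ hH => hM S DB Q H hDB hQ hH.isGeneralizedDecomposition⟩
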